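/- **Setting.** Let $A$ be a commutative $\mathbb{Q}$-algebra with a derivation $\partial_z$ (functions of $z$, e.g. $C^\infty(I)$ or $\mathbb{C}[[z]]$). Functions of $(z,t)$, $t=(t_1,t_3,t_5,\dots)$, $x=t_1$, are formal power series in $t$ with coefficients in $A$; put $\partial=\partial_x$. A pseudo-differential operator is a formal series $P=\sum_{i\le N}a_i\partial^i$ in such functions, with $\partial^i a=\sum_{k\ge0}\binom ik a^{(k)}\partial^{i-k}$; $P_+$ and $P_-$ are its parts with $i\ge0$ and $i<0$, and $P^*=\sum_i(-\partial)^ia_i$. Let $\xi(t,\lambda)=\sum_{n\ \mathrm{odd}}t_n\lambda^n$ and $P(e^{\xi})=\sum_i a_i\lambda^i e^{\xi}$, a power series in $t$ whose coefficients are formal Laurent series in $\lambda^{-1}$; $\mathrm{res}_\lambda$ is the coefficient of $\lambda^{-1}$. Fix functions $q,r$. All flows are for $n=1,3,5,\dots$ For $L=\partial+\sum_{i\ge1}u_i\partial^{-i}$ and $B_n=(L^n)_+$, the *BKP hierarchy with its squared eigenfunction symmetry* is $$L_{t_n}=[B_n,L],\quad L^*=-\partial L\partial^{-1},\quad L_z=[r\partial^{-1}q_x-q\partial^{-1}r_x,L],\quad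 q_{t_n}=B_n(q),\quad r_{t_n}=B_n(r).\tag{1}$$ A dressing operator of $L$ is $W=1+\sum_{i\ge1}w_i\partial^{-i}$ with $L=W\partial W^{-1}$; its wave function is $w(t,\lambda)=W(e^{\xi(t,\lambda)})$ (the common argument $z$ is suppressed). The *residue identities* for $(W,q,r)$ are the following identities of formal power series in two independent sets of times $t,t'$: $$\mathrm{res}_\lambda\,\lambda^{-1}w(t,\lambda)w(t',-\lambda)=1,\tag{2a}$$ $$\mathrm{res}_\lambda\,\lambda^{-1}w_z(t,\lambda)w(t',-\lambda)=q(t)r(t')-r(t)q(t'),\tag{2b}$$ $$q(t)=\mathrm{res}_\lambda\,\lambda^{-1}w(t,\lambda)\,\partial_{x'}^{-1}\bigl(q(t')w_{x'}(t',-\lambda)\bigr),\tag{2c}$$ $$r(t)=\mathrm{res}_\lambda\,\lambda^{-1}w(t,\lambda)\,\partial_{x'}^{-1}\bigl(r(t')w_{x'}(t',-\lambda)\bigr),\tag{2d}$$ where $\partial^{-1}(q\,w_x)$ means $(\partial^{-1}q\,\partial W)(e^{\xi})$, with the composition taken in the ring of pseudo-differential operators. **Theorem.** 1. Let $W$ be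 a dressing operator of $L$. Then the system $$W_{t_n}=-(L^n)_-W,\quad W^*\partial W=\partial,\quad W_z=(r\partial^{-1}q_x-q\partial^{-1}r_x)W,\quad q_{t_n}=B_n(q),\quad r_{t_n}=B_n(r)$$ holds if and only if the residue identities (2a)–(2d) hold for $(W,q,r)$. 2. If $W=1+\sum_{i\ge1}w_i\partial^{-i}$, $q$, $r$ satisfy (2a)–(2d), then $L=W\partial W^{-1}$, $q$, $r$ satisfy (1). 3. Suppose every element of $A$ has a $\partial_z$-antiderivative in $A$. Then for every $L$, the triple $(L,q,r)$ satisfies (1) if and only if $L$ has a dressing operator $W$ such that (2a)–(2d) hold for $(W,q,r)$. -/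

import Mathlib

open MvPowerSeries

noncomputable section

namespace BKP

/-! Functions of `t = (t₁, t₃, t₅, …)` (with `x = t₁`) are formal power series with
coefficients in a commutative `ℚ`-algebra `A` of functions of `z`. The time `t_{2k+1}`
is the variable of index `k : ℕ`. -/

/-- Functions of `(z, t)`. -/
abbrev Fn (A : Type*) := MvPowerSeries ℕ A

/-- Formal Laurent series in `λ⁻¹`: for `f : Lau A` the coefficient of `λ ^ (-n)` is
`f.coeff n`. -/
abbrev Lau (A : Type*) [Zero A] := LaurentSeries A

variable {A : Type*} [CommRing A]

/-- `∂ = ∂_x = ∂_{t₁}` on functions. -/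
def dx (f : Fn A) : Fn A := pderiv A 0 f

/-- Apply a map to every coefficient of a power series. -/
def mapCoeff {σ B C : Type*} [Semiring B] [Semiring C] (g : B → C)
    (f : MvPowerSeries σ B) : MvPowerSeries σ C := fun m => g (coeff m f)

/-- A pseudo-differential operator `∑_{i ≤ N} aᵢ ∂ⁱ`. -/
@[ext] structure PDO (A : Type*) [CommRing A] where
  /-- The coefficient `aᵢ` of `∂ⁱ`. -/
  coeff : ℤ → Fn A
  bdd : ∃ N : ℤ, ∀ i, N < i → coeff i = 0

namespace PDO

/-- The operator `a ∂ʲ`. -/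
def mono (a : Fn A) (j : ℤ) : PDO A where
  coeff i := if i = j then a else 0
  bdd := ⟨j, fun i hi => if_neg (by omega)⟩

/-- Multiplication by a function. -/
def fn (a : Fn A) : PDO A := mono a 0

/-- `∂`. -/
def del : PDO A := mono 1 1

/-- `∂⁻¹`. -/
def delInv : PDO A := mono 1 (-1)

instance : One (PDO A) := ⟨mono 1 0⟩

instance : Neg (PDO A) where
  neg P :=
    { coeff := fun i => -P.coeff i
      bdd := by
        obtain ⟨N, hN⟩ := P.bdd
        exact ⟨N, fun i hi => by rw [hN i hi, neg_zero]⟩ }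

instance : Sub (PDO A) where
  sub P Q :=
    { coeff := fun i => P.coeff i - Q.coeff i
      bdd := by
        obtain ⟨N, hN⟩ := P.bdd
        obtain ⟨M, hM⟩ := Q.bdd
        exact ⟨max N M, fun i hi => by
          rw [hN i (lt_of_le_of_lt (le_max_left _ _) hi),
            hM i (lt_of_le_of_lt (le_max_right _ _) hi), sub_zero]⟩ }

/-- Composition, determined by `∂ⁱ ∘ b = ∑_{k ≥ 0} (i choose k) b^{(k)} ∂^{i-k}`. The sum giving
the coefficient of `∂ᵐ` runs over all `aᵢ ∂ⁱ`, `b_j ∂ʲ` and `k ≥ 0` with `i + j - k = m`,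
and only finitely many terms are nonzero. -/
instance : Mul (PDO A) where
  mul P Q :=
    { coeff := fun m => ∑ᶠ p : ℤ × ℕ,
        Ring.choose p.1 p.2 • (P.coeff p.1 * dx^[p.2] (Q.coeff (m - p.1 + p.2)))
      bdd := by
        obtain ⟨N, hN⟩ := P.bdd
        obtain ⟨M, hM⟩ := Q.bdd
        refine ⟨N + M, fun m hm => finsum_eq_zero_of_forall_eq_zero fun p => ?_⟩
        by_cases h : N < p.1
        · rw [hN _ h, zero_mul, smul_zero]
        · rw [hM _ (by omega), show dx^[p.2] (0 : Fn A) = 0 from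
            Function.iterate_fixed (map_zero (pderiv A 0)) _, mul_zero, smul_zero] }

/-- Powers `Pⁿ`. -/
def pow (P : PDO A) : ℕ → PDO A
  | 0 => 1
  | n + 1 => P * pow P n

/-- The commutator `[P, Q]`. -/
def comm (P Q : PDO A) : PDO A := P * Q - Q * P

/-- The non-negative part `P₊`. -/
def pos (P : PDO A) : PDO A where
  coeff i := if 0 ≤ i then P.coeff i else 0
  bdd := by
    obtain ⟨N, hN⟩ := P.bdd
    exact ⟨N, fun i hi => by rw [hN i hi, ite_self]⟩

/-- The negative part `P₋`. -/
def negPart (P : PDO A) : PDO A where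
  coeff i := if i < 0 then P.coeff i else 0
  bdd := ⟨0, fun i hi => if_neg (by omega)⟩

/-- The formal adjoint `P* = ∑ᵢ (-∂)ⁱ ∘ aᵢ`, expanded: the coefficient of `∂ᵐ` collects
`(-1)ⁱ (i choose k) aᵢ^{(k)}` over `i = m + k`, `k ≥ 0`. -/
def adj (P : PDO A) : PDO A where
  coeff m := ∑ᶠ k : ℕ, ((Int.negOnePow (m + k) : ℤˣ) : ℤ) •
    Ring.choose (m + k) k • dx^[k] (P.coeff (m + k))
  bdd := by
    obtain ⟨N, hN⟩ := P.bdd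
    refine ⟨N, fun m hm => finsum_eq_zero_of_forall_eq_zero fun k => ?_⟩
    rw [hN _ (by omega), show dx^[k] (0 : Fn A) = 0 from
      Function.iterate_fixed (map_zero (pderiv A 0)) _, smul_zero, smul_zero]

/-- The action `B(q) = ∑_{i ≥ 0} bᵢ q^{(i)}` of a differential operator on a function. -/
def act (B : PDO A) (q : Fn A) : Fn A := ∑ᶠ i : ℕ, B.coeff i * dx^[i] q

/-- `∂P/∂t_{2k+1}`, coefficientwise. -/
def dt (k : ℕ) (P : PDO A) : PDO A where
  coeff i := pderiv A k (P.coeff i)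
  bdd := by
    obtain ⟨N, hN⟩ := P.bdd
    exact ⟨N, fun i hi => by rw [hN i hi, map_zero]⟩

/-- `∂P/∂z`, coefficientwise; `δ` is the derivation `∂_z` of `A`. -/
def dz [Algebra ℚ A] (δ : Derivation ℚ A A) (P : PDO A) : PDO A where
  coeff i := mapCoeff δ (P.coeff i)
  bdd := by
    obtain ⟨N, hN⟩ := P.bdd
    refine ⟨N, fun i hi => ?_⟩
    rw [hN i hi]
    funext m
    exact (congrArg δ (map_zero (MvPowerSeries.coeff m))).trans (map_zero δ)

/-- The symbol `∑ᵢ aᵢ λⁱ`. -/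
def symbol (P : PDO A) : MvPowerSeries ℕ (Lau A) := fun m =>
  HahnSeries.ofSuppBddBelow (fun n : ℤ => MvPowerSeries.coeff m (P.coeff (-n))) (by
    obtain ⟨N, hN⟩ := P.bdd
    refine ⟨-N, fun n hn => ?_⟩
    by_contra h
    exact hn (by simp [hN (-n) (by omega)]))

end PDO

open PDO

/-- `e^{ξ(t,λ)}`, `ξ(t,λ) = ∑_k t_{2k+1} λ^{2k+1}`: the coefficient of `∏_k t_{2k+1}^{m_k}` is
`∏_k λ^{(2k+1) m_k} / m_k!`. -/
def expXi (A : Type*) [CommRing A] [Algebra ℚ A] : MvPowerSeries ℕ (Lau A) := fun m =>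
  HahnSeries.single (-(m.sum fun k e => ((2 * k + 1) * e : ℤ)))
    (algebraMap ℚ A (m.prod fun _ e => (e.factorial : ℚ)⁻¹))

variable [Algebra ℚ A]

/-- `P(e^{ξ(t,λ)})`, where `∂ⁱ e^ξ = λⁱ e^ξ` for every `i : ℤ`. -/
def PDO.onExp (P : PDO A) : MvPowerSeries ℕ (Lau A) := P.symbol * expXi A

/-- The substitution `λ ↦ -λ`. -/
def flip (f : Lau A) : Lau A where
  coeff n := ((Int.negOnePow n : ℤˣ) : ℤ) • f.coeff n
  isPWO_support' := f.isPWO_support.mono fun n hn h => hn (by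
    change f.coeff n = 0 at h
    simp [h])

/-- `f(t)`, seen as a function of `(t, t')`. -/
def unprimed {B : Type*} [CommRing B] (f : MvPowerSeries ℕ B) : MvPowerSeries (ℕ ⊕ ℕ) B :=
  haveI := Filter.tendstoCofinite_of_injective (Sum.inl_injective (α := ℕ) (β := ℕ))
  rename Sum.inl f

/-- `f(t')`, seen as a function of `(t, t')`. -/
def primed {B : Type*} [CommRing B] (f : MvPowerSeries ℕ B) : MvPowerSeries (ℕ ⊕ ℕ) B :=
  haveI := Filter.tendstoCofinite_of_injective (Sum.inr_injective (α := ℕ) (β := ℕ))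
  rename Sum.inr f

/-- `res_λ`, the coefficient of `λ⁻¹`. -/
def res (F : MvPowerSeries (ℕ ⊕ ℕ) (Lau A)) : MvPowerSeries (ℕ ⊕ ℕ) A :=
  mapCoeff (fun f => f.coeff 1) F

/-- Multiplication by `λ⁻¹`, as a constant series. -/
def lamInv : MvPowerSeries (ℕ ⊕ ℕ) (Lau A) := C (HahnSeries.single 1 1)

/-- `L = ∂ + ∑_{i ≥ 1} uᵢ ∂⁻ⁱ`. -/
def IsLaxForm (L : PDO A) : Prop := L.coeff 1 = 1 ∧ L.coeff 0 = 0 ∧ ∀ i, 1 < i → L.coeff i = 0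

/-- `Bₙ = (Lⁿ)₊`. -/
def B (L : PDO A) (n : ℕ) : PDO A := (L.pow n).pos

/-- `r ∂⁻¹ q_x - q ∂⁻¹ r_x`. -/
def ghost (q r : Fn A) : PDO A := fn r * delInv * fn (dx q) - fn q * delInv * fn (dx r)

/-- `q_{t_n} = Bₙ(q)` for all odd `n`. -/
def IsEigenfunction (L : PDO A) (q : Fn A) : Prop :=
  ∀ k : ℕ, pderiv A k q = (B L (2 * k + 1)).act q

/-- `(L, q, r)` is a solution of the BKP hierarchy with its squared eigenfunction flow. -/
structure IsSolution (δ : Derivation ℚ A A) (L : PDO A) (q r : Fn A) : Prop where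
  form : IsLaxForm L
  lax : ∀ k : ℕ, L.dt k = comm (B L (2 * k + 1)) L
  constraint : L.adj = -(del * L * delInv)
  ghost_flow : L.dz δ = comm (ghost q r) L
  eigen_q : IsEigenfunction L q
  eigen_r : IsEigenfunction L r

/-- `W = 1 + ∑_{i ≥ 1} wᵢ ∂⁻ⁱ` and `L = W ∂ W⁻¹`. -/
def Dresses (W L : PDO A) : Prop :=
  (W.coeff 0 = 1 ∧ ∀ i, 0 < i → W.coeff i = 0) ∧
    ∃ V : PDO A, W * V = 1 ∧ V * W = 1 ∧ L = W * del * V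

/-- The hierarchy in terms of the dressing operator `W` of `L`. -/
structure IsDressedSolution (δ : Derivation ℚ A A) (L W : PDO A) (q r : Fn A) : Prop where
  sato : ∀ k : ℕ, W.dt k = -((L.pow (2 * k + 1)).negPart * W)
  constraint : W.adj * del * W = del
  ghost_flow : W.dz δ = ghost q r * W
  eigen_q : IsEigenfunction L q
  eigen_r : IsEigenfunction L r

/-- The wave function `w(z,t,λ) = W e^{ξ(t,λ)}`. -/
def wave (W : PDO A) : MvPowerSeries ℕ (Lau A) := W.onExp

/-- `w_z`. -/
def waveZ (δ : Derivation ℚ A A) (W : PDO A) : MvPowerSeries ℕ (Lau A) :=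
  mapCoeff (fun f => f.map δ) (wave W)

/-- `∂⁻¹(q w_x)`, understood as `(∂⁻¹ q ∂ W)(e^ξ)`. -/
def intWave (q : Fn A) (W : PDO A) : MvPowerSeries ℕ (Lau A) :=
  (delInv * fn q * del * W).onExp

/-- The four residue identities, as identities between formal power series in `(t, t')`. -/
structure ResidueIdentities (δ : Derivation ℚ A A) (W : PDO A) (q r : Fn A) : Prop where
  ww : res (lamInv * unprimed (wave W) * primed (mapCoeff flip (wave W))) = 1
  wzw : res (lamInv * unprimed (waveZ δ W) * primed (mapCoeff flip (wave W))) =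
    unprimed q * primed r - unprimed r * primed q
  repr_q : unprimed q =
    res (lamInv * unprimed (wave W) * primed (mapCoeff flip (intWave q W)))
  repr_r : unprimed r =
    res (lamInv * unprimed (wave W) * primed (mapCoeff flip (intWave r W)))

end BKP

end

/-! A residue pairing of wave functions is an operator in disguise. Let `pairing P Q` be the residue
of λ⁻¹ P(e^ξ)(t, λ) Q(e^ξ)(t', -λ). Since ξ is odd in λ, the exponentials cancel at t' = t, and the
diagonal value is the ∂⁻¹-coefficient of P ∂⁻¹ Q* (`diag_pairing`). An x-derivative of the pairing
replaces P by ∂P, and the residues of ∂ⁱR for all i determine R modulo differential operators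
(`isDiff_of_forall_residue`). In the same dictionary f(t)g(t') corresponds to f ∂⁻¹ g
(`diag_iterate_dx`).

From the identities to the hierarchy: each identity, restricted to the diagonal together with its
x-derivatives, becomes an operator identity modulo differential operators. Both sides of it have
order at most -1, so it is exact. Thus (2a) gives W ∂⁻¹ W* = ∂⁻¹, which is the BKP constraint, and
its tₙ-derivative gives the Sato equation; (2b) gives W_z ∂⁻¹ W* = q ∂⁻¹ r - r ∂⁻¹ q, which is the
ghost flow after an integration by parts (`ghost_mul_delInv`). Differentiating (2c) and (2d) in tₙ
and using w_{tₙ} = Bₙ w gives the eigenfunction equations.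

From the hierarchy to the identities: both sides of each identity solve the linear evolution F_{tₙ}
= Bₙ F, and their x-derivatives agree on the diagonal, so they coincide by Taylor expansion
(`eq_zero_of_evolution`). For the right-hand side 1 this needs Bₙ(1) = 0 (`coeff_zero_B`), a
consequence of the constraint.

For part 3 a dressing operator has to be found from L. The equations for W say that W is horizontal
for the operators ∂_{tₙ} + (Lⁿ)₋ and ∂_z - (r ∂⁻¹ q_x - q ∂⁻¹ r_x). The hierarchy makes this
connection flat and compatible with the constraint (`IsSolution.isFlatConnection`). W is then built
one coefficient at a time (`IsApproxDressing.exists_correction`): at alternate orders the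
coefficient is a potential supplied by the Poincaré lemma, at the others it is forced by W* ∂ W = ∂
and solves the flow equations automatically. -/

noncomputable section

namespace BKP

variable {A : Type*} [CommRing A]

/-! ### Iterated x-derivatives. -/

section dx

/-- The iterated derivative `dx^[k]` as an additive homomorphism. -/
def dxIter (k : ℕ) : Fn A →+ Fn A where
  toFun := dx^[k]
  map_zero' := Function.iterate_fixed (map_zero (pderiv A 0)) _
  map_add' := by
    induction k with
    | zero => intro f g; rfl
    | succ k ih => intro f g; rw [Function.iterate_succ_apply, dx, map_add]; exact ih _ _

@[simp] theorem dxIter_zero_apply (f : Fn A) : dxIter 0 f = f := rfl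

theorem dxIter_succ (k : ℕ) (f : Fn A) : dxIter (k + 1) f = dxIter k (dx f) := rfl

theorem dxIter_succ' (k : ℕ) (f : Fn A) : dxIter (k + 1) f = dx (dxIter k f) :=
  Function.iterate_succ_apply' dx k f

@[simp] theorem dxIter_one_apply (f : Fn A) : dxIter 1 f = dx f := rfl

theorem dxIter_add (k l : ℕ) (f : Fn A) : dxIter (k + l) f = dxIter k (dxIter l f) :=
  Function.iterate_add_apply dx k l f

theorem dxIter_one {k : ℕ} (hk : k ≠ 0) : dxIter k (1 : Fn A) = 0 := by
  obtain ⟨k, rfl⟩ := Nat.exists_eq_succ_of_ne_zero hk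
  rw [Nat.succ_eq_add_one, dxIter_succ, dx, Derivation.map_one_eq_zero, map_zero]

theorem dx_zero : dx (0 : Fn A) = 0 := map_zero (pderiv A 0)

theorem dx_mul (f g : Fn A) : dx (f * g) = dx f * g + f * dx g := by
  simp only [dx, Derivation.leibniz, smul_eq_mul]; ring

theorem dxIter_mul (n : ℕ) (f g : Fn A) : dxIter n (f * g) =
    ∑ p ∈ Finset.HasAntidiagonal.antidiagonal n, n.choose p.1 • (dxIter p.1 f * dxIter p.2 g) := by
  induction n with
  | zero => simp
  | succ n ih =>
    rw [Finset.sum_antidiagonal_choose_succ_nsmul (fun i j => dxIter i f * dxIter j g),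
      dxIter_succ', ih, dx, map_sum, ← Finset.sum_add_distrib]
    refine Finset.sum_congr rfl fun p hp => ?_
    rw [Finset.HasAntidiagonal.mem_antidiagonal] at hp
    have h : n.choose p.2 = n.choose p.1 := Nat.choose_symm_of_eq_add (by omega)
    rw [map_nsmul, h, dxIter_succ', dxIter_succ', ← smul_add]
    congr 1
    rw [add_comm]
    exact dx_mul _ _

end dx

/-! ### The ring of pseudo-differential operators. -/

namespace PDO

theorem coeff_mul (P Q : PDO A) (m : ℤ) : (P * Q).coeff m = ∑ᶠ p : ℤ × ℕ,
    Ring.choose p.1 p.2 • (P.coeff p.1 * dxIter p.2 (Q.coeff (m - p.1 + p.2))) := rfl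

@[simp] theorem coeff_neg (P : PDO A) (i : ℤ) : (-P).coeff i = -P.coeff i := rfl

@[simp] theorem coeff_sub (P Q : PDO A) (i : ℤ) : (P - Q).coeff i = P.coeff i - Q.coeff i := rfl

theorem coeff_mono (a : Fn A) (j i : ℤ) : (mono a j).coeff i = if i = j then a else 0 := rfl

@[simp] theorem coeff_mono_self (a : Fn A) (j : ℤ) : (mono a j).coeff j = a := if_pos rfl

theorem coeff_mono_of_ne (a : Fn A) {i j : ℤ} (h : i ≠ j) : (mono a j).coeff i = 0 := if_neg h

/-- `P` has order at most `N`. -/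
def OrdLE (P : PDO A) (N : ℤ) : Prop := ∀ i, N < i → P.coeff i = 0

theorem OrdLE.mono_bound {P : PDO A} {N M : ℤ} (h : OrdLE P N) (hNM : N ≤ M) : OrdLE P M :=
  fun i hi => h i (by omega)

theorem ordLE_mono (a : Fn A) (j : ℤ) : OrdLE (mono a j) j :=
  fun _ hi => coeff_mono_of_ne a (by omega)

instance : Zero (PDO A) := ⟨⟨fun _ => 0, 0, fun _ _ => rfl⟩⟩

instance : Add (PDO A) where
  add P Q :=
    { coeff := fun i => P.coeff i + Q.coeff i
      bdd := by
        obtain ⟨N, hN⟩ := P.bdd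
        obtain ⟨M, hM⟩ := Q.bdd
        exact ⟨max N M, fun i hi => by
          rw [hN i (lt_of_le_of_lt (le_max_left _ _) hi),
            hM i (lt_of_le_of_lt (le_max_right _ _) hi), add_zero]⟩ }

@[simp] theorem coeff_zero (i : ℤ) : (0 : PDO A).coeff i = 0 := rfl

@[simp] theorem coeff_add (P Q : PDO A) (i : ℤ) : (P + Q).coeff i = P.coeff i + Q.coeff i := rfl

theorem ext' {P Q : PDO A} (h : ∀ i, P.coeff i = Q.coeff i) : P = Q := PDO.ext (funext h)

instance : AddCommGroup (PDO A) where
  add_assoc P Q R := ext' fun i => add_assoc _ _ _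
  zero_add P := ext' fun i => zero_add _
  add_zero P := ext' fun i => add_zero _
  add_comm P Q := ext' fun i => add_comm _ _
  neg_add_cancel P := ext' fun i => neg_add_cancel _
  sub_eq_add_neg P Q := ext' fun i => sub_eq_add_neg _ _
  nsmul := nsmulRec
  zsmul := zsmulRec

/-- The coefficient of `∂ⁱ` as an additive homomorphism. -/
def coeffHom (i : ℤ) : PDO A →+ Fn A where
  toFun P := P.coeff i
  map_zero' := rfl
  map_add' _ _ := rfl

theorem coeff_sum {ι : Type*} (s : Finset ι) (f : ι → PDO A) (i : ℤ) :
    (∑ j ∈ s, f j).coeff i = ∑ j ∈ s, (f j).coeff i := map_sum (coeffHom i) f s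

theorem coeff_zsmul (n : ℤ) (P : PDO A) (i : ℤ) : (n • P).coeff i = n • P.coeff i :=
  map_zsmul (coeffHom i) n P

theorem exists_ordLE (P : PDO A) : ∃ N, OrdLE P N := P.bdd

theorem ordLE_zero (N : ℤ) : OrdLE (0 : PDO A) N := fun _ _ => rfl

theorem OrdLE.add {P Q : PDO A} {N : ℤ} (hP : OrdLE P N) (hQ : OrdLE Q N) : OrdLE (P + Q) N :=
  fun i hi => by rw [coeff_add, hP i hi, hQ i hi, add_zero]

theorem OrdLE.neg {P : PDO A} {N : ℤ} (hP : OrdLE P N) : OrdLE (-P) N :=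
  fun i hi => by rw [coeff_neg, hP i hi, neg_zero]

theorem OrdLE.sub {P Q : PDO A} {N : ℤ} (hP : OrdLE P N) (hQ : OrdLE Q N) : OrdLE (P - Q) N :=
  fun i hi => by rw [coeff_sub, hP i hi, hQ i hi, sub_zero]

/-- An operator of order at most `N` with vanishing coefficient of `∂ᴺ` has order at
most `N - 1`. -/
theorem OrdLE.lower {P : PDO A} {N : ℤ} (hP : OrdLE P N) (h : P.coeff N = 0) : OrdLE P (N - 1) :=
  fun i hi => by
    rcases eq_or_ne i N with rfl | hne
    · exact h
    · exact hP i (by omega)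

theorem eq_zero_of_forall_ordLE {P : PDO A} (h : ∀ n : ℕ, OrdLE P (-n)) : P = 0 :=
  ext' fun i => h (i.natAbs + 1) i (by omega)

theorem mono_neg (a : Fn A) (j : ℤ) : mono (-a) j = -mono a j :=
  ext' fun i => by simp only [coeff_neg, coeff_mono]; split_ifs <;> simp

/-- Additive maps that vanish on operators of small order are determined by their values on the
operators `b ∂ʲ`. -/
theorem hom_ext {M : Type*} [AddCommGroup M] {Φ Ψ : PDO A →+ M} (K : ℤ)
    (hΦ : ∀ P, OrdLE P K → Φ P = 0) (hΨ : ∀ P, OrdLE P K → Ψ P = 0)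
    (h : ∀ b j, Φ (mono b j) = Ψ (mono b j)) : Φ = Ψ := by
  -- Peel off the leading term until the order drops to `K`, where both maps vanish; no continuity
  -- is needed.
  have key : ∀ n : ℕ, ∀ P : PDO A, OrdLE P (K + n) → Φ P = Ψ P := by
    intro n
    induction n with
    | zero => intro P hP; rw [hΦ P (by simpa using hP), hΨ P (by simpa using hP)]
    | succ n ih =>
      intro P hP
      set b := P.coeff (K + n + 1)
      have h1 : OrdLE (P - mono b (K + n + 1)) (K + n) := by
        have h2 : OrdLE (P - mono b (K + n + 1)) (K + n + 1) :=
          (hP.mono_bound (by push_cast; omega)).sub (ordLE_mono _ _)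
        simpa using h2.lower (by simp [b])
      have h3 := ih _ h1
      rw [map_sub, map_sub, h] at h3
      exact sub_left_injective h3
  ext P
  obtain ⟨N, hN⟩ := P.exists_ordLE
  exact key (N - K).toNat P (hN.mono_bound (by omega))

theorem mulTerm_support_subset {P Q : PDO A} {N M : ℤ} (hP : OrdLE P N) (hQ : OrdLE Q M) (m : ℤ) :
    (Function.support fun p : ℤ × ℕ => Ring.choose p.1 p.2 •
      (P.coeff p.1 * dxIter p.2 (Q.coeff (m - p.1 + p.2)))) ⊆
      ↑(Finset.Icc (m - M) N ×ˢ Finset.range ((N + M - m).toNat + 1)) := by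
  intro p hp
  have h1 : p.1 ≤ N := by
    by_contra h
    exact hp (by simp only [hP _ (not_le.mp h), zero_mul, smul_zero])
  have h2 : m - p.1 + p.2 ≤ M := by
    by_contra h
    exact hp (by simp only [hQ _ (not_le.mp h), map_zero, mul_zero, smul_zero])
  simp only [Finset.coe_product, Set.mem_prod, Finset.mem_coe, Finset.mem_Icc, Finset.mem_range]
  omega

theorem OrdLE.mul {P Q : PDO A} {N M : ℤ} (hP : OrdLE P N) (hQ : OrdLE Q M) :
    OrdLE (P * Q) (N + M) := fun i hi => by
  refine finsum_eq_zero_of_forall_eq_zero fun p => ?_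
  by_contra h
  have := mulTerm_support_subset hP hQ i h
  simp only [Finset.coe_product, Set.mem_prod, Finset.mem_coe, Finset.mem_Icc,
    Finset.mem_range] at this
  omega

theorem mulTerm_finite (P Q : PDO A) (m : ℤ) : (Function.support fun p : ℤ × ℕ =>
    Ring.choose p.1 p.2 • (P.coeff p.1 * dxIter p.2 (Q.coeff (m - p.1 + p.2)))).Finite := by
  obtain ⟨N, hN⟩ := P.exists_ordLE
  obtain ⟨M, hM⟩ := Q.exists_ordLE
  exact (Finset.finite_toSet _).subset (mulTerm_support_subset hN hM m)

instance : NonUnitalNonAssocRing (PDO A) where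
  left_distrib P Q R := ext' fun m => by
    rw [coeff_add, coeff_mul, coeff_mul, coeff_mul,
      ← finsum_add_distrib (mulTerm_finite P Q m) (mulTerm_finite P R m)]
    exact finsum_congr fun p => by rw [coeff_add, map_add, mul_add, smul_add]
  right_distrib P Q R := ext' fun m => by
    rw [coeff_add, coeff_mul, coeff_mul, coeff_mul,
      ← finsum_add_distrib (mulTerm_finite P R m) (mulTerm_finite Q R m)]
    exact finsum_congr fun p => by rw [coeff_add, add_mul, smul_add]
  zero_mul P := ext' fun m => finsum_eq_zero_of_forall_eq_zero fun p => by
    rw [coeff_zero, zero_mul, smul_zero]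
  mul_zero P := ext' fun m => finsum_eq_zero_of_forall_eq_zero fun p => by
    rw [coeff_zero]; exact (congrArg _ (congrArg _ (map_zero (dxIter p.2)))).trans (by simp)

/-- The coefficient of top order of a product. -/
theorem coeff_mul_top {P Q : PDO A} {N M : ℤ} (hP : OrdLE P N) (hQ : OrdLE Q M) :
    (P * Q).coeff (N + M) = P.coeff N * Q.coeff M := by
  rw [coeff_mul, finsum_eq_single _ (N, 0)]
  · simp
  · intro p hp
    by_contra h
    have := mulTerm_support_subset hP hQ (N + M) h
    simp only [Finset.coe_product, Set.mem_prod, Finset.mem_coe, Finset.mem_Icc,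
      Finset.mem_range] at this
    exact hp (Prod.ext (by simp; omega) (by simp; omega))

theorem coeff_mono_mul {Q : PDO A} {M : ℤ} (hQ : OrdLE Q M) (a : Fn A) (i m : ℤ) (T : ℕ)
    (hT : i + M - m ≤ T) : (mono a i * Q).coeff m =
    ∑ k ∈ Finset.range (T + 1), Ring.choose i k • (a * dxIter k (Q.coeff (m - i + k))) := by
  rw [coeff_mul, finsum_eq_sum_of_support_subset _
    (s := (Finset.range (T + 1)).image fun k => (i, k))]
  · rw [Finset.sum_image fun _ _ _ _ h => (Prod.ext_iff.mp h).2]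
    simp
  · intro p hp
    have h1 : p.1 = i := by
      by_contra h
      exact hp (by simp only [coeff_mono_of_ne a h, zero_mul, smul_zero])
    have h2 := mulTerm_support_subset (ordLE_mono a i) hQ m hp
    simp only [Finset.coe_product, Set.mem_prod, Finset.mem_coe, Finset.mem_Icc,
      Finset.mem_range] at h2
    simp only [Finset.coe_image, Set.mem_image, Finset.mem_coe,
      Finset.mem_range]
    exact ⟨p.2, by omega, Prod.ext h1.symm rfl⟩

theorem coeff_mul_mono {P : PDO A} {N : ℤ} (hP : OrdLE P N) (c : Fn A) (k m : ℤ) (T : ℕ)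
    (hT : N + k - m ≤ T) : (P * mono c k).coeff m =
    ∑ l ∈ Finset.range (T + 1), Ring.choose (m - k + l) l • (P.coeff (m - k + l) * dxIter l c) := by
  rw [coeff_mul, finsum_eq_sum_of_support_subset _ (s := (Finset.range (T + 1)).image
    fun l : ℕ => (m - k + l, l))]
  · rw [Finset.sum_image fun _ _ _ _ h => (Prod.ext_iff.mp h).2]
    refine Finset.sum_congr rfl fun l _ => ?_
    rw [show m - (m - k + l) + l = k by ring, coeff_mono_self]
  · intro p hp
    have h1 : m - p.1 + p.2 = k := by
      by_contra h
      exact hp (by simp only [coeff_mono_of_ne c h, map_zero, mul_zero, smul_zero])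
    have h2 := mulTerm_support_subset hP (ordLE_mono c k) m hp
    simp only [Finset.coe_product, Set.mem_prod, Finset.mem_coe, Finset.mem_Icc,
      Finset.mem_range] at h2
    simp only [Finset.coe_image, Set.mem_image, Finset.mem_coe,
      Finset.mem_range]
    exact ⟨p.2, by omega, Prod.ext (by simp; omega) rfl⟩

theorem coeff_mono_mul_mono (a b : Fn A) (i j : ℤ) (s : ℕ) :
    (mono a i * mono b j).coeff (i + j - s) = Ring.choose i s • (a * dxIter s b) := by
  rw [coeff_mono_mul (ordLE_mono b j) a i _ s (by omega), Finset.sum_eq_single s]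
  · rw [show i + j - s - i + s = j by ring, coeff_mono_self]
  · intro k _ hk
    rw [coeff_mono_of_ne b (by omega), map_zero, mul_zero, smul_zero]
  · intro h; simp at h

/-- Trinomial revision turns the first two factors into C(i, s) C(i - s, p), and Vandermonde for (i
- s) + j sums the rest. This is the numerical content of associativity. -/
theorem choose_vandermonde (i j : ℤ) (s l : ℕ) :
    ∑ p ∈ Finset.HasAntidiagonal.antidiagonal l, ((s + p.1).choose s : ℤ) * (Ring.choose i (s + p.1) *
      Ring.choose j p.2) = Ring.choose i s * Ring.choose (i + j - s) l := by
  rw [show i + j - s = (i - s) + j by ring, Ring.add_choose_eq l (Commute.all _ _), Finset.mul_sum]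
  refine Finset.sum_congr rfl fun p _ => ?_
  have := Ring.choose_smul_choose i (Nat.le_add_right s p.1)
  rw [nsmul_eq_mul, Nat.add_sub_cancel_left] at this
  rw [← mul_assoc, ← mul_assoc, this]

theorem mono_mul_assoc (a b c : Fn A) (i j k : ℤ) :
    mono a i * mono b j * mono c k = mono a i * (mono b j * mono c k) := by
  ext1
  funext m
  have hab := (ordLE_mono a i).mul (ordLE_mono b j)
  have hbc := (ordLE_mono b j).mul (ordLE_mono c k)
  by_cases hm : i + j + k < m
  · rw [hab.mul (ordLE_mono c k) m hm, (ordLE_mono a i).mul hbc m (by omega)]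
  obtain ⟨T, rfl⟩ : ∃ T : ℕ, m = i + j + k - T := ⟨(i + j + k - m).toNat, by omega⟩
  rw [coeff_mul_mono hab c k _ T (by omega), coeff_mono_mul hbc a i _ T (by omega)]
  have hL : ∀ l ∈ Finset.range (T + 1), Ring.choose (i + j + k - T - k + l) l •
      ((mono a i * mono b j).coeff (i + j + k - T - k + l) * dxIter l c) =
      (Ring.choose i (T - l) * Ring.choose (i + j - (T - l : ℕ)) l) •
        (a * dxIter (T - l) b * dxIter l c) := by
    intro l hl
    rw [Finset.mem_range] at hl
    rw [show i + j + k - T - k + l = i + j - (T - l : ℕ) by omega, coeff_mono_mul_mono,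
      smul_mul_assoc, smul_smul, mul_comm (Ring.choose i _)]
  have hR : ∀ p ∈ Finset.range (T + 1), Ring.choose i p •
      (a * dxIter p ((mono b j * mono c k).coeff (i + j + k - T - i + p))) =
      ∑ x ∈ Finset.HasAntidiagonal.antidiagonal p, ((p.choose x.1 : ℤ) * (Ring.choose i p *
        Ring.choose j (T - p))) • (a * dxIter x.1 b * dxIter (x.2 + (T - p)) c) := by
    intro p hp
    rw [Finset.mem_range] at hp
    rw [show i + j + k - T - i + p = j + k - (T - p : ℕ) by omega, coeff_mono_mul_mono,
      map_zsmul, dxIter_mul, Finset.smul_sum, Finset.mul_sum, Finset.smul_sum]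
    refine Finset.sum_congr rfl fun x _ => ?_
    rw [dxIter_add, mul_smul_comm, mul_smul_comm, smul_smul, ← natCast_zsmul, smul_smul,
      mul_comm (_ * Ring.choose j _), ← mul_assoc a]
  rw [Finset.sum_congr rfl hL, Finset.sum_congr rfl hR,
    ← Finset.Nat.sum_antidiagonal_eq_sum_range_succ (fun p q => ∑ x ∈ Finset.HasAntidiagonal.antidiagonal p,
      ((p.choose x.1 : ℤ) * (Ring.choose i p * Ring.choose j q)) •
        (a * dxIter x.1 b * dxIter (x.2 + q) c)) T, ← Finset.sum_range_reflect]
  have hL' : ∀ l ∈ Finset.range (T + 1),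
      (Ring.choose i (T - (T + 1 - 1 - l)) * Ring.choose (i + j - (T - (T + 1 - 1 - l) : ℕ))
        (T + 1 - 1 - l)) • (a * dxIter (T - (T + 1 - 1 - l)) b * dxIter (T + 1 - 1 - l) c) =
      (Ring.choose i l * Ring.choose (i + j - l) (T - l)) •
        (a * dxIter l b * dxIter (T - l) c) := by
    intro l hl
    rw [Finset.mem_range] at hl
    rw [Nat.add_sub_cancel, Nat.sub_sub_self (by omega)]
  rw [Finset.sum_congr rfl hL', ← Finset.Nat.sum_antidiagonal_eq_sum_range_succ (fun s l =>
    (Ring.choose i s * Ring.choose (i + j - s) l) • (a * dxIter s b * dxIter l c)) T]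
  have h1 : ∀ p ∈ Finset.HasAntidiagonal.antidiagonal T, (Ring.choose i p.1 * Ring.choose (i + j - p.1) p.2) •
      (a * dxIter p.1 b * dxIter p.2 c) = ∑ x ∈ Finset.HasAntidiagonal.antidiagonal p.2,
        (((p.1 + x.1).choose p.1 : ℤ) * (Ring.choose i (p.1 + x.1) * Ring.choose j x.2)) •
        (a * dxIter p.1 b * dxIter (x.1 + x.2) c) := by
    intro p _
    rw [← choose_vandermonde, Finset.sum_smul]
    refine Finset.sum_congr rfl fun x hx => ?_
    rw [Finset.HasAntidiagonal.mem_antidiagonal.mp hx]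
  rw [Finset.sum_congr rfl h1, Finset.sum_sigma', Finset.sum_sigma']
  -- Both sums run over triples (s, u, v) with s + u + v = T, bracketed as s + (u + v) on the left
  -- and as (s + u) + v on the right.
  refine Finset.sum_nbij' (fun y => ⟨(y.1.1 + y.2.1, y.2.2), (y.1.1, y.2.1)⟩)
    (fun y => ⟨(y.2.1, y.2.2 + y.1.2), (y.2.2, y.1.2)⟩) ?_ ?_ ?_ ?_ ?_
  · rintro ⟨⟨u, v⟩, ⟨w, x⟩⟩ h
    simp only [Finset.mem_sigma, Finset.HasAntidiagonal.mem_antidiagonal] at h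
    obtain ⟨rfl, rfl⟩ := h
    simp [add_assoc]
  · rintro ⟨⟨u, v⟩, ⟨w, x⟩⟩ h
    simp only [Finset.mem_sigma, Finset.HasAntidiagonal.mem_antidiagonal] at h
    obtain ⟨rfl, rfl⟩ := h
    simp [add_assoc]
  · rintro ⟨⟨u, v⟩, ⟨w, x⟩⟩ h
    simp only [Finset.mem_sigma, Finset.HasAntidiagonal.mem_antidiagonal] at h
    obtain ⟨rfl, rfl⟩ := h
    rfl
  · rintro ⟨⟨u, v⟩, ⟨w, x⟩⟩ h
    simp only [Finset.mem_sigma, Finset.HasAntidiagonal.mem_antidiagonal] at h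
    obtain ⟨rfl, rfl⟩ := h
    rfl
  · rintro ⟨⟨u, v⟩, ⟨w, x⟩⟩ h
    rfl

/-- One coefficient of a product ignores factors of low enough order, so `hom_ext` reduces each
factor in turn to a single term a ∂ⁱ; the cutoffs keep the total order below `m`. -/
protected theorem mul_assoc (P Q R : PDO A) : P * Q * R = P * (Q * R) := by
  ext1
  funext m
  obtain ⟨N, hN⟩ := P.exists_ordLE
  obtain ⟨M, hM⟩ := Q.exists_ordLE
  obtain ⟨K, hK⟩ := R.exists_ordLE
  have hR : ∀ a i b j, (coeffHom m).comp (AddMonoidHom.mulLeft (mono a i * mono b j : PDO A)) =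
      (coeffHom m).comp ((AddMonoidHom.mulLeft (mono a i)).comp
        (AddMonoidHom.mulLeft (mono b j))) := fun a i b j =>
    hom_ext (m - 1 - (i + j))
      (fun S hS => ((ordLE_mono a i).mul (ordLE_mono b j)).mul hS m (by omega))
      (fun S hS => (ordLE_mono a i).mul ((ordLE_mono b j).mul hS) m (by omega))
      (fun c k => congrArg (coeffHom m) (mono_mul_assoc a b c i j k))
  have hQ : ∀ a i, (coeffHom m).comp ((AddMonoidHom.mulRight R).comp
      (AddMonoidHom.mulLeft (mono a i : PDO A))) =
      (coeffHom m).comp ((AddMonoidHom.mulLeft (mono a i)).comp (AddMonoidHom.mulRight R)) :=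
    fun a i => hom_ext (m - 1 - (i + K))
      (fun S hS => ((ordLE_mono a i).mul hS).mul hK m (by omega))
      (fun S hS => (ordLE_mono a i).mul (hS.mul hK) m (by omega))
      (fun b j => DFunLike.congr_fun (hR a i b j) R)
  have hP : (coeffHom m).comp ((AddMonoidHom.mulRight R).comp (AddMonoidHom.mulRight Q)) =
      (coeffHom m).comp (AddMonoidHom.mulRight (Q * R)) :=
    hom_ext (m - 1 - (M + K))
      (fun S hS => (hS.mul hM).mul hK m (by omega))
      (fun S hS => hS.mul (hM.mul hK) m (by omega))
      (fun a i => DFunLike.congr_fun (hQ a i) Q)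
  exact DFunLike.congr_fun hP P

theorem coeff_mul_monoOne (P : PDO A) (j m : ℤ) : (P * mono 1 j).coeff m = P.coeff (m - j) := by
  obtain ⟨N, hN⟩ := P.exists_ordLE
  rw [coeff_mul_mono hN 1 j m (N + j - m).toNat (by omega), Finset.sum_eq_single 0]
  · simp
  · intro k _ hk
    rw [dxIter_one hk, mul_zero, smul_zero]
  · intro h; simp at h

theorem coeff_fn_mul (a : Fn A) (P : PDO A) (m : ℤ) : (fn a * P).coeff m = a * P.coeff m := by
  obtain ⟨N, hN⟩ := P.exists_ordLE
  rw [fn, coeff_mono_mul hN a 0 m (N - m).toNat (by omega), Finset.sum_eq_single 0]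
  · simp
  · intro k _ hk
    rw [Ring.choose_zero_pos ℤ (Nat.pos_of_ne_zero hk), zero_smul]
  · intro h; simp at h

instance : Ring (PDO A) where
  mul_assoc := PDO.mul_assoc
  one_mul P := ext' fun m => (coeff_fn_mul 1 P m).trans (one_mul _)
  mul_one P := ext' fun m => (coeff_mul_monoOne P 0 m).trans (by rw [sub_zero])
  zero_mul := zero_mul
  mul_zero := mul_zero
  left_distrib := mul_add
  right_distrib := add_mul
  sub_eq_add_neg := sub_eq_add_neg
  zsmul := (· • ·)
  zsmul_zero' := SubNegMonoid.zsmul_zero'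
  zsmul_succ' := SubNegMonoid.zsmul_succ'
  zsmul_neg' := SubNegMonoid.zsmul_neg'
  neg_add_cancel := neg_add_cancel

theorem pow_eq (P : PDO A) (n : ℕ) : P.pow n = P ^ n := by
  induction n with
  | zero => rw [pow_zero]; rfl
  | succ n ih => rw [pow_succ', ← ih]; rfl

theorem one_def : (1 : PDO A) = mono 1 0 := rfl

end PDO

end BKP

namespace BKP

variable {A : Type*} [CommRing A]

namespace PDO

/-- Additive endomorphisms of bounded order are determined by their values on the operators
`b ∂ʲ`. -/
theorem endo_ext {Φ Ψ : PDO A →+ PDO A} (d : ℤ) (hΦ : ∀ P N, OrdLE P N → OrdLE (Φ P) (N + d))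
    (hΨ : ∀ P N, OrdLE P N → OrdLE (Ψ P) (N + d)) (h : ∀ b j, Φ (mono b j) = Ψ (mono b j)) :
    Φ = Ψ := by
  ext1 P
  refine ext' fun m => ?_
  have : (coeffHom m).comp Φ = (coeffHom m).comp Ψ := hom_ext (m - 1 - d)
    (fun P hP => hΦ P _ hP m (by omega)) (fun P hP => hΨ P _ hP m (by omega))
    (fun b j => congrArg (coeffHom m) (h b j))
  exact DFunLike.congr_fun this P

/-! ### Explicit products with ∂, ∂⁻¹ and functions. -/

section basic

theorem choose_nat_eq_zero {n k : ℕ} (h : n < k) : Ring.choose (n : ℤ) k = 0 := by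
  rw [Ring.choose_natCast, Nat.choose_eq_zero_of_lt h, Nat.cast_zero]

theorem choose_self_int (l : ℕ) : Ring.choose (l : ℤ) l = 1 := by
  rw [Ring.choose_natCast, Nat.choose_self, Nat.cast_one]

theorem coeff_del_mul (P : PDO A) (m : ℤ) :
    (del * P).coeff m = dx (P.coeff m) + P.coeff (m - 1) := by
  obtain ⟨N, hN⟩ := P.exists_ordLE
  rw [del, coeff_mono_mul hN 1 1 m ((1 + N - m).toNat + 1) (by omega), Finset.sum_range_succ',
    Finset.sum_range_succ', Finset.sum_eq_zero]
  · have : Ring.choose (1 : ℤ) 1 = 1 := choose_self_int 1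
    simp [this]
  · intro k _
    have : Ring.choose (1 : ℤ) (k + 1 + 1) = 0 := choose_nat_eq_zero (n := 1) (by omega)
    rw [this, zero_smul]

theorem monoOne_mul_monoOne (i j : ℤ) : (mono 1 i * mono 1 j : PDO A) = mono 1 (i + j) :=
  ext' fun m => by
    rw [coeff_mul_monoOne, coeff_mono, coeff_mono]
    exact if_congr (by omega) rfl rfl

theorem del_mul_delInv : (del * delInv : PDO A) = 1 := monoOne_mul_monoOne 1 (-1)

theorem delInv_mul_del : (delInv * del : PDO A) = 1 := monoOne_mul_monoOne (-1) 1

theorem del_mul_delInv_mul (P : PDO A) : del * (delInv * P) = P := by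
  rw [← mul_assoc, del_mul_delInv, one_mul]

theorem delInv_mul_del_mul (P : PDO A) : delInv * (del * P) = P := by
  rw [← mul_assoc, delInv_mul_del, one_mul]

theorem del_pow (k : ℕ) : (del ^ k : PDO A) = mono 1 k := by
  induction k with
  | zero => rfl
  | succ k ih => rw [pow_succ, ih, del, monoOne_mul_monoOne, Nat.cast_succ]

theorem coeff_mul_del (P : PDO A) (m : ℤ) : (P * del).coeff m = P.coeff (m - 1) :=
  coeff_mul_monoOne P 1 m

theorem coeff_mul_delInv (P : PDO A) (m : ℤ) : (P * delInv).coeff m = P.coeff (m + 1) :=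
  (coeff_mul_monoOne P (-1) m).trans (by rw [sub_neg_eq_add])

theorem fn_mul_mono (a b : Fn A) (j : ℤ) : fn a * mono b j = mono (a * b) j :=
  ext' fun i => by rw [coeff_fn_mul, coeff_mono, coeff_mono, mul_ite, mul_zero]

theorem mono_eq (a : Fn A) (j : ℤ) : mono a j = fn a * mono 1 j := by rw [fn_mul_mono, mul_one]

theorem fn_mul (a b : Fn A) : fn (a * b) = fn a * fn b := (fn_mul_mono a b 0).symm

theorem fn_one : (fn 1 : PDO A) = 1 := rfl

theorem fn_neg (a : Fn A) : fn (-a) = -fn a := mono_neg a 0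

theorem fn_mul_comm (a b : Fn A) : fn a * fn b = fn b * fn a := by
  rw [← fn_mul, mul_comm, fn_mul]

theorem ordLE_fn (a : Fn A) : OrdLE (fn a) 0 := ordLE_mono a 0

theorem ordLE_one : OrdLE (1 : PDO A) 0 := ordLE_mono 1 0

theorem ordLE_del : OrdLE (del : PDO A) 1 := ordLE_mono 1 1

theorem ordLE_delInv : OrdLE (delInv : PDO A) (-1) := ordLE_mono 1 (-1)

theorem del_mul_fn (a : Fn A) : del * fn a = fn a * del + fn (dx a) := ext' fun m => by
  rw [coeff_del_mul, coeff_add, coeff_mul_del, fn, fn, coeff_mono, coeff_mono, coeff_mono]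
  split_ifs <;> first | omega | simp [dx_zero]

theorem fn_dx (a : Fn A) : fn (dx a) = del * fn a - fn a * del := by rw [del_mul_fn]; abel

theorem del_mul_mono (b : Fn A) (j : ℤ) : del * mono b j = mono b (j + 1) + mono (dx b) j := by
  rw [mono_eq b j, ← mul_assoc, del_mul_fn, add_mul, mul_assoc, del, monoOne_mul_monoOne,
    ← mono_eq, ← mono_eq, add_comm 1]

/-- The coefficient of `∂⁻¹` of `P ∘ b`. -/
theorem coeff_mul_fn_neg_one (P : PDO A) (b : Fn A) : (P * fn b).coeff (-1) = P.coeff (-1) * b := by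
  obtain ⟨N, hN⟩ := P.exists_ordLE
  rw [fn, coeff_mul_mono hN b 0 (-1) (N + 1).toNat (by omega), Finset.sum_eq_single 0]
  · simp only [Nat.cast_zero, add_zero, sub_zero, Ring.choose_zero_right, one_smul,
      dxIter_zero_apply]
  · intro k _ hk
    obtain ⟨k, rfl⟩ := Nat.exists_eq_succ_of_ne_zero hk
    -- The term with k + 1 derivatives of `b` carries C(k, k + 1) = 0.
    rw [show (-1 - 0 + (k.succ : ℕ) : ℤ) = (k : ℕ) by push_cast; ring,
      choose_nat_eq_zero (by omega), zero_smul]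
  · intro h; exact absurd (Finset.mem_range.mpr (Nat.succ_pos _)) h

theorem act_eq_finset_sum {P : PDO A} {N : ℤ} (hN : OrdLE P N) (q : Fn A) (T : ℕ) (hT : N ≤ T) :
    P.act q = ∑ l ∈ Finset.range (T + 1), P.coeff l * dxIter l q := by
  refine finsum_eq_sum_of_support_subset _ fun l hl => ?_
  by_contra h
  simp only [Finset.mem_coe, Finset.mem_range] at h
  exact hl (by simp only [hN l (by omega), zero_mul])

theorem act_eq (P : PDO A) (q : Fn A) : P.act q = (P * fn q).coeff 0 := by
  obtain ⟨N, hN⟩ := P.exists_ordLE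
  rw [act_eq_finset_sum hN q N.toNat (by omega), fn,
    coeff_mul_mono hN q 0 0 N.toNat (by omega)]
  refine Finset.sum_congr rfl fun l _ => ?_
  rw [show (0 - 0 + l : ℤ) = l by ring, choose_self_int, one_smul]

end basic

/-! ### Differential and negative parts. -/

section parts

/-- `P` is a differential operator. -/
def IsDiff (P : PDO A) : Prop := ∀ i, i < 0 → P.coeff i = 0

theorem IsDiff.add {P Q : PDO A} (hP : IsDiff P) (hQ : IsDiff Q) : IsDiff (P + Q) :=
  fun i hi => by rw [coeff_add, hP i hi, hQ i hi, add_zero]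

theorem IsDiff.sub {P Q : PDO A} (hP : IsDiff P) (hQ : IsDiff Q) : IsDiff (P - Q) :=
  fun i hi => by rw [coeff_sub, hP i hi, hQ i hi, sub_zero]

theorem isDiff_mono (a : Fn A) {j : ℤ} (hj : 0 ≤ j) : IsDiff (mono a j) :=
  fun _ hi => coeff_mono_of_ne a (by omega)

theorem isDiff_fn (a : Fn A) : IsDiff (fn a) := isDiff_mono a le_rfl

theorem isDiff_del : IsDiff (del : PDO A) := isDiff_mono 1 zero_le_one

theorem IsDiff.mul {P Q : PDO A} (hP : IsDiff P) (hQ : IsDiff Q) : IsDiff (P * Q) := by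
  intro m hm
  rw [coeff_mul]
  refine finsum_eq_zero_of_forall_eq_zero fun p => ?_
  rcases lt_or_ge p.1 0 with h1 | h1
  · rw [hP _ h1, zero_mul, smul_zero]
  rcases lt_or_ge (m - p.1 + p.2) 0 with h2 | h2
  · rw [hQ _ h2, map_zero, mul_zero, smul_zero]
  obtain ⟨n, hn⟩ := Int.eq_ofNat_of_zero_le h1
  rw [hn, choose_nat_eq_zero (by omega), zero_smul]

theorem coeff_pos (P : PDO A) (i : ℤ) : P.pos.coeff i = if 0 ≤ i then P.coeff i else 0 := rfl

theorem coeff_negPart (P : PDO A) (i : ℤ) : P.negPart.coeff i = if i < 0 then P.coeff i else 0 :=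
  rfl

theorem isDiff_pos (P : PDO A) : IsDiff P.pos := fun i hi => if_neg (by omega)

theorem ordLE_negPart (P : PDO A) : OrdLE P.negPart (-1) := fun i hi => if_neg (by omega)

theorem pos_add_negPart (P : PDO A) : P.pos + P.negPart = P := ext' fun i => by
  rw [coeff_add, coeff_pos, coeff_negPart]
  split_ifs <;> first | omega | simp

theorem pos_eq (P : PDO A) : P.pos = P - P.negPart := eq_sub_of_add_eq (pos_add_negPart P)

theorem negPart_add (P Q : PDO A) : (P + Q).negPart = P.negPart + Q.negPart := ext' fun i => by
  rw [coeff_add, coeff_negPart, coeff_negPart, coeff_negPart]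
  split_ifs <;> simp

theorem negPart_neg (P : PDO A) : (-P).negPart = -P.negPart := ext' fun i => by
  rw [coeff_neg, coeff_negPart, coeff_negPart]
  split_ifs <;> simp

theorem negPart_sub (P Q : PDO A) : (P - Q).negPart = P.negPart - Q.negPart := by
  rw [sub_eq_add_neg, negPart_add, negPart_neg, sub_eq_add_neg]

theorem IsDiff.negPart_eq_zero {P : PDO A} (h : IsDiff P) : P.negPart = 0 := ext' fun i => by
  rw [coeff_negPart]
  split_ifs with hi
  · exact h i hi
  · rfl

theorem OrdLE.negPart_eq {P : PDO A} (h : OrdLE P (-1)) : P.negPart = P := ext' fun i => by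
  rw [coeff_negPart]
  split_ifs with hi
  · rfl
  · exact (h i (by omega)).symm

theorem OrdLE.mul_neg {P Q : PDO A} (hP : OrdLE P (-1)) (hQ : OrdLE Q (-1)) : OrdLE (P * Q) (-1) :=
  (hP.mul hQ).mono_bound (by norm_num)

/-- The residue of ∂ⁿR is the coefficient of ∂⁻¹⁻ⁿ in R plus derivatives of the coefficients of ∂⁻¹,
…, ∂⁻ⁿ, so the system is triangular and strong induction applies. -/
theorem isDiff_of_forall_residue {R : PDO A}
    (h : ∀ k : ℕ, (del ^ k * R).coeff (-1) = 0) : IsDiff R := by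
  have key : ∀ n : ℕ, R.coeff (-1 - n) = 0 := by
    intro n
    induction n using Nat.strong_induction_on with
    | _ n ih =>
      obtain ⟨N, hN⟩ := R.exists_ordLE
      have h1 := h n
      rw [del_pow, coeff_mono_mul hN 1 n (-1) (n + N + 1).toNat (by omega),
        Finset.sum_eq_single 0] at h1
      · simpa using h1
      · intro k _ hk
        rcases lt_or_ge n k with h2 | h2
        · rw [choose_nat_eq_zero h2, zero_smul]
        · rw [show (-1 - n + k : ℤ) = -1 - ((n - k : ℕ) : ℤ) by omega, ih _ (by omega), map_zero,
            mul_zero, smul_zero]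
      · intro h; simp at h
  intro i hi
  rw [show i = -1 - ((-1 - i).toNat : ℤ) by omega]
  exact key _

/-- Only the zeroth coefficient of X survives: X ∂⁻¹ differs from X₀ ∂⁻¹ by a differential operator,
and right multiplication by `g` preserves this. -/
theorem negPart_diff_mul_delInv_mul {X : PDO A} (hX : IsDiff X) (g : Fn A) :
    (X * delInv * fn g).negPart = fn (X.coeff 0) * delInv * fn g := by
  have h1 : IsDiff (X * delInv - fn (X.coeff 0) * delInv) := fun i hi => by
    rw [coeff_sub, coeff_mul_delInv, coeff_mul_delInv, fn, coeff_mono]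
    split_ifs with h
    · rw [h, sub_self]
    · rw [hX _ (by omega), sub_zero]
  have h2 := (h1.mul (isDiff_fn g)).negPart_eq_zero
  rw [sub_mul, negPart_sub, sub_eq_zero] at h2
  rw [h2]
  exact ((((ordLE_fn _).mul ordLE_delInv).mul (ordLE_fn g)).mono_bound (by norm_num)).negPart_eq

theorem negPart_diff_mul_mul {B : PDO A} (hB : IsDiff B) (f g : Fn A) :
    (B * (fn f * delInv * fn g)).negPart = fn (B.act f) * delInv * fn g := by
  rw [act_eq, ← negPart_diff_mul_delInv_mul (hB.mul (isDiff_fn f))]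
  simp only [mul_assoc]

end parts

/-! ### The formal adjoint. -/

section adjoint

theorem coeff_adj (P : PDO A) (m : ℤ) : P.adj.coeff m = ∑ᶠ k : ℕ,
    ((Int.negOnePow (m + k) : ℤˣ) : ℤ) • Ring.choose (m + k) k • dxIter k (P.coeff (m + k)) := rfl

theorem coeff_adj_eq_sum {P : PDO A} {N : ℤ} (hP : OrdLE P N) (m : ℤ) (T : ℕ) (hT : N - m ≤ T) :
    P.adj.coeff m = ∑ k ∈ Finset.range (T + 1), ((Int.negOnePow (m + k) : ℤˣ) : ℤ) •
      Ring.choose (m + k) k • dxIter k (P.coeff (m + k)) := by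
  rw [coeff_adj]
  refine finsum_eq_sum_of_support_subset _ fun l hl => ?_
  by_contra h
  simp only [Finset.mem_coe, Finset.mem_range] at h
  exact hl (by simp only [hP (m + l) (by omega), map_zero, smul_zero])

theorem OrdLE.adj {P : PDO A} {N : ℤ} (hP : OrdLE P N) : OrdLE P.adj N := fun m hm => by
  rw [coeff_adj]
  exact finsum_eq_zero_of_forall_eq_zero fun k => by
    rw [hP (m + k) (by omega), map_zero, smul_zero, smul_zero]

theorem coeff_adj_top {P : PDO A} {N : ℤ} (hP : OrdLE P N) :
    P.adj.coeff N = ((Int.negOnePow N : ℤˣ) : ℤ) • P.coeff N := by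
  rw [coeff_adj_eq_sum hP N 0 (by simp)]
  simp

theorem IsDiff.adj {P : PDO A} (hP : IsDiff P) : IsDiff P.adj := fun m hm => by
  rw [coeff_adj]
  refine finsum_eq_zero_of_forall_eq_zero fun k => ?_
  rcases lt_or_ge (m + k) 0 with h1 | h1
  · rw [hP _ h1, map_zero, smul_zero, smul_zero]
  · obtain ⟨n, hn⟩ := Int.eq_ofNat_of_zero_le h1
    rw [hn, choose_nat_eq_zero (by omega), zero_smul, smul_zero]

/-- The formal adjoint as an additive homomorphism. -/
def adjHom : PDO A →+ PDO A where
  toFun := adj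
  map_zero' := ext' fun m => by
    rw [coeff_adj]
    exact finsum_eq_zero_of_forall_eq_zero fun k => by
      rw [coeff_zero, map_zero, smul_zero, smul_zero]
  map_add' P Q := ext' fun m => by
    obtain ⟨N, hN⟩ := P.exists_ordLE
    obtain ⟨M, hM⟩ := Q.exists_ordLE
    have hN' := hN.mono_bound (le_max_left N M)
    have hM' := hM.mono_bound (le_max_right N M)
    rw [coeff_add, coeff_adj_eq_sum hN' m (max N M - m).toNat (by omega),
      coeff_adj_eq_sum hM' m (max N M - m).toNat (by omega),
      coeff_adj_eq_sum (hN'.add hM') m (max N M - m).toNat (by omega), ← Finset.sum_add_distrib]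
    exact Finset.sum_congr rfl fun k _ => by rw [coeff_add, map_add, smul_add, smul_add]

theorem adj_add (P Q : PDO A) : (P + Q).adj = P.adj + Q.adj := map_add adjHom P Q

theorem adj_sub (P Q : PDO A) : (P - Q).adj = P.adj - Q.adj := map_sub adjHom P Q

theorem adj_neg (P : PDO A) : (-P).adj = -P.adj := map_neg adjHom P

theorem adj_zsmul (n : ℤ) (P : PDO A) : (n • P).adj = n • P.adj := map_zsmul adjHom n P

theorem adj_mono (b : Fn A) (j : ℤ) :
    (mono b j).adj = ((Int.negOnePow j : ℤˣ) : ℤ) • (mono 1 j * fn b) := ext' fun m => by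
  rw [coeff_zsmul]
  by_cases hm : j < m
  · rw [(ordLE_mono b j).adj m hm, ((ordLE_mono 1 j).mul (ordLE_fn b)) m (by omega), smul_zero]
  obtain ⟨s, rfl⟩ : ∃ s : ℕ, m = j + 0 - s := ⟨(j - m).toNat, by omega⟩
  rw [fn, coeff_mono_mul_mono, one_mul, coeff_adj_eq_sum (ordLE_mono b j) _ s (by omega),
    Finset.sum_eq_single s]
  · rw [show j + 0 - s + s = j by ring, coeff_mono_self]
  · intro k _ hk
    rw [coeff_mono_of_ne b (by omega), map_zero, smul_zero, smul_zero]
  · intro h; simp at h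

theorem adj_fn (a : Fn A) : (fn a).adj = fn a := by
  rw [fn, adj_mono, Int.negOnePow_zero, Units.val_one, one_smul]
  exact one_mul _

theorem adj_one : (1 : PDO A).adj = 1 := adj_fn 1

theorem adj_monoOne (j : ℤ) : (mono 1 j : PDO A).adj = ((Int.negOnePow j : ℤˣ) : ℤ) • mono 1 j := by
  rw [adj_mono, fn_one, mul_one]

theorem adj_del : (del : PDO A).adj = -del := by
  rw [del, adj_monoOne, Int.negOnePow_one, Units.val_neg, Units.val_one, neg_smul, one_smul]

theorem adj_delInv : (delInv : PDO A).adj = -delInv := by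
  rw [delInv, adj_monoOne, Int.negOnePow_neg, Int.negOnePow_one, Units.val_neg, Units.val_one,
    neg_smul, one_smul]

theorem adj_fn_mul (a : Fn A) (Q : PDO A) : (fn a * Q).adj = Q.adj * fn a := by
  have : adjHom.comp (AddMonoidHom.mulLeft (fn a)) =
      (AddMonoidHom.mulRight (fn a)).comp adjHom := endo_ext 0
    (fun P N hP => (((ordLE_fn a).mul hP).mono_bound (by omega)).adj)
    (fun P N hP => hP.adj.mul (ordLE_fn a)) fun b j => by
      change (fn a * mono b j).adj = (mono b j).adj * fn a
      rw [fn_mul_mono, adj_mono, adj_mono, smul_mul_assoc, mul_comm a, fn_mul, mul_assoc]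
  exact DFunLike.congr_fun this Q

theorem adj_del_mul (Q : PDO A) : (del * Q).adj = -(Q.adj * del) := by
  have : adjHom.comp (AddMonoidHom.mulLeft (del : PDO A)) =
      (AddMonoidHom.mulRight (-del)).comp adjHom := endo_ext 1
    (fun P N hP => ((ordLE_del.mul hP).mono_bound (by omega)).adj)
    (fun P N hP => hP.adj.mul ordLE_del.neg) fun b j => by
      change (del * mono b j).adj = (mono b j).adj * -del
      rw [del_mul_mono, adj_add, adj_mono, adj_mono, adj_mono, fn_dx, Int.negOnePow_succ,
        Units.val_neg, neg_smul, ← smul_neg, ← smul_add, smul_mul_assoc, mul_neg,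
        ← monoOne_mul_monoOne, ← del, mul_assoc, mul_sub, mul_assoc]
      congr 1
      abel
  exact (DFunLike.congr_fun this Q).trans (mul_neg _ _)

theorem adj_delInv_mul (Q : PDO A) : (delInv * Q).adj = -(Q.adj * delInv) := by
  have h := adj_del_mul (delInv * Q)
  rw [del_mul_delInv_mul] at h
  rw [h, neg_mul, neg_neg, mul_assoc, del_mul_delInv, mul_one]

theorem adj_monoOne_mul (i : ℤ) (Q : PDO A) :
    (mono 1 i * Q).adj = Q.adj * (mono 1 i).adj := by
  induction i using Int.induction_on generalizing Q with
  | zero => rw [← one_def, one_mul, adj_one, mul_one]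
  | succ i ih =>
    rw [← monoOne_mul_monoOne, mul_assoc, ih, ← del, adj_del_mul, ih, adj_del]
    simp only [neg_mul, mul_neg, mul_assoc]
  | pred i ih =>
    rw [sub_eq_add_neg, ← monoOne_mul_monoOne, mul_assoc, ih, ← delInv, adj_delInv_mul, ih,
      adj_delInv]
    simp only [neg_mul, mul_neg, mul_assoc]

/-- It suffices to let P = b ∂ʲ, and then to move functions, ∂ and ∂⁻¹ across one at a time; for ∂
the rule is the Leibniz rule. -/
theorem adj_mul (P Q : PDO A) : (P * Q).adj = Q.adj * P.adj := by
  obtain ⟨M, hM⟩ := Q.exists_ordLE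
  have : adjHom.comp (AddMonoidHom.mulRight Q) =
      (AddMonoidHom.mulLeft Q.adj).comp adjHom := endo_ext M
    (fun P N hP => (hP.mul hM).adj)
    (fun P N hP => (hM.adj.mul hP.adj).mono_bound (by omega)) fun b j => by
      change (mono b j * Q).adj = Q.adj * (mono b j).adj
      rw [mono_eq, mul_assoc, adj_fn_mul, adj_monoOne_mul, adj_fn_mul, mul_assoc]
  exact DFunLike.congr_fun this P

theorem adj_adj (P : PDO A) : P.adj.adj = P := by
  have : adjHom.comp adjHom = AddMonoidHom.id (PDO A) := endo_ext 0
    (fun P N hP => hP.adj.adj.mono_bound (by omega))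
    (fun P N hP => hP.mono_bound (by omega)) fun b j => by
      change (mono b j).adj.adj = mono b j
      rw [mono_eq b j, adj_mul, adj_mul, adj_fn, adj_monoOne, adj_fn, adj_zsmul, adj_monoOne,
        smul_smul, ← Units.val_mul, ← Int.negOnePow_add, Int.negOnePow_even _ ⟨j, rfl⟩,
        Units.val_one, one_smul]
  exact DFunLike.congr_fun this P

theorem adj_negPart (P : PDO A) : P.adj.negPart = P.negPart.adj := by
  conv_lhs => rw [← pos_add_negPart P, adj_add, negPart_add]
  rw [(isDiff_pos P).adj.negPart_eq_zero, zero_add, (ordLE_negPart P).adj.negPart_eq]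

theorem adj_pow (P : PDO A) (n : ℕ) : (P ^ n).adj = P.adj ^ n := by
  induction n with
  | zero => exact adj_one
  | succ n ih => rw [pow_succ, adj_mul, ih, pow_succ']

theorem adj_fn_delInv_fn (f g : Fn A) :
    (fn f * delInv * fn g).adj = -(fn g * delInv * fn f) := by
  rw [adj_mul, adj_mul, adj_fn, adj_fn, adj_delInv, neg_mul, mul_neg, mul_assoc]

/-- The adjoint of `negPart_diff_mul_mul`: taking adjoints commutes with the negative part and swaps
the two outer functions up to sign. -/
theorem negPart_mul_diff {B : PDO A} (hB : IsDiff B) (f g : Fn A) :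
    (fn f * delInv * fn g * B).negPart = fn f * delInv * fn (B.adj.act g) := by
  have h := negPart_diff_mul_mul hB.adj g f
  rw [← neg_inj, ← negPart_neg, ← mul_neg, ← adj_fn_delInv_fn, ← adj_mul, adj_negPart] at h
  rw [← adj_adj (_ : PDO A).negPart, h, adj_neg, adj_fn_delInv_fn, neg_neg]

end adjoint

/-! ### The derivations ∂_{tₙ} and ∂_z acting on operators. -/

section derivations

/-- Apply an additive endomorphism to every coefficient. -/
def mapFn (D : Fn A →+ Fn A) (P : PDO A) : PDO A where
  coeff i := D (P.coeff i)
  bdd := by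
    obtain ⟨N, hN⟩ := P.bdd
    exact ⟨N, fun i hi => by rw [hN i hi, map_zero]⟩

theorem mapFn_mul {D : Fn A →+ Fn A} (hD : ∀ f g, D (f * g) = D f * g + f * D g)
    (hdx : ∀ f, D (dx f) = dx (D f)) (P Q : PDO A) :
    mapFn D (P * Q) = mapFn D P * Q + P * mapFn D Q := ext' fun m => by
  have hdx' : ∀ k f, D (dxIter k f) = dxIter k (D f) := by
    intro k
    induction k with
    | zero => intro f; rfl
    | succ k ih => intro f; rw [dxIter_succ, ih, hdx, ← dxIter_succ]
  rw [coeff_add, coeff_mul, coeff_mul, ← finsum_add_distrib (mulTerm_finite (mapFn D P) Q m)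
    (mulTerm_finite P (mapFn D Q) m)]
  change D ((P * Q).coeff m) = _
  rw [coeff_mul, AddMonoidHom.map_finsum _ (mulTerm_finite P Q m)]
  refine finsum_congr fun p => ?_
  rw [map_zsmul, hD, hdx', smul_add]
  rfl

theorem pderiv_comm {σ R : Type*} [CommSemiring R] (i j : σ) (f : MvPowerSeries σ R) :
    pderiv R i (pderiv R j f) = pderiv R j (pderiv R i f) := by
  classical
  ext n
  rw [coeff_pderiv, coeff_pderiv, coeff_pderiv, coeff_pderiv, add_right_comm n]
  rcases eq_or_ne i j with rfl | h
  · rfl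
  · rw [Finsupp.add_apply, Finsupp.add_apply, Finsupp.single_eq_of_ne h,
      Finsupp.single_eq_of_ne h.symm, add_zero, add_zero]
    ring

theorem dt_mul (k : ℕ) (P Q : PDO A) : (P * Q).dt k = P.dt k * Q + P * Q.dt k :=
  mapFn_mul (D := (pderiv A k).toLinearMap.toAddMonoidHom)
    (fun f g => by
      change pderiv A k (f * g) = pderiv A k f * g + f * pderiv A k g
      rw [Derivation.leibniz, smul_eq_mul, smul_eq_mul]; ring)
    (fun f => pderiv_comm k 0 f) P Q

@[simp] theorem coeff_dt (k : ℕ) (P : PDO A) (i : ℤ) :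
    (P.dt k).coeff i = pderiv A k (P.coeff i) := rfl

theorem dt_neg (k : ℕ) (P : PDO A) : (-P).dt k = -P.dt k := ext' fun _ => map_neg _ _

theorem dt_sub (k : ℕ) (P Q : PDO A) : (P - Q).dt k = P.dt k - Q.dt k :=
  ext' fun _ => map_sub _ _ _

theorem dt_monoOne (k : ℕ) (j : ℤ) : (mono 1 j : PDO A).dt k = 0 := ext' fun i => by
  rw [coeff_dt, coeff_mono]
  split_ifs
  · exact Derivation.map_one_eq_zero _
  · exact map_zero _

theorem dt_del (k : ℕ) : (del : PDO A).dt k = 0 := dt_monoOne k 1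

theorem dt_delInv (k : ℕ) : (delInv : PDO A).dt k = 0 := dt_monoOne k (-1)

theorem dt_one (k : ℕ) : (1 : PDO A).dt k = 0 := dt_monoOne k 0

theorem dt_fn (k : ℕ) (a : Fn A) : (fn a).dt k = fn (pderiv A k a) := ext' fun i => by
  rw [coeff_dt, fn, fn, coeff_mono, coeff_mono]
  split_ifs
  · rfl
  · exact map_zero _

theorem OrdLE.dt {P : PDO A} {N : ℤ} (hP : OrdLE P N) (k : ℕ) : OrdLE (P.dt k) N :=
  fun i hi => by rw [coeff_dt, hP i hi, map_zero]

theorem negPart_dt (k : ℕ) (P : PDO A) : (P.dt k).negPart = P.negPart.dt k := ext' fun i => by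
  rw [coeff_dt, coeff_negPart, coeff_negPart]
  split_ifs
  · rfl
  · exact (map_zero _).symm

theorem dt_dt (j k : ℕ) (P : PDO A) : (P.dt k).dt j = (P.dt j).dt k :=
  ext' fun i => pderiv_comm j k (P.coeff i)

theorem dt_adj (k : ℕ) (P : PDO A) : P.adj.dt k = (P.dt k).adj := ext' fun m => by
  obtain ⟨N, hN⟩ := P.exists_ordLE
  have h : ∀ l f, pderiv A k (dxIter l f) = dxIter l (pderiv A k f) := by
    intro l
    induction l with
    | zero => intro f; rfl
    | succ l ih => intro f; rw [dxIter_succ, ih, dx, pderiv_comm, ← dx, ← dxIter_succ]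
  rw [coeff_dt, coeff_adj_eq_sum hN m (N - m).toNat (by omega),
    coeff_adj_eq_sum (hN.dt k) m (N - m).toNat (by omega), map_sum]
  exact Finset.sum_congr rfl fun l _ => by rw [map_zsmul, map_zsmul, h, coeff_dt]

variable [Algebra ℚ A] (δ : Derivation ℚ A A)

/-- `∂_z` on functions, as an additive homomorphism. -/
def dzFn : Fn A →+ Fn A where
  toFun := mapCoeff δ
  map_zero' := by
    funext m
    exact (congrArg δ (map_zero (MvPowerSeries.coeff m))).trans (map_zero δ)
  map_add' f g := by
    funext m
    exact (congrArg δ (map_add (MvPowerSeries.coeff m) f g)).trans (map_add δ _ _)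

theorem coeff_dzFn (f : Fn A) (m : ℕ →₀ ℕ) :
    MvPowerSeries.coeff m (dzFn δ f) = δ (MvPowerSeries.coeff m f) := rfl

theorem dzFn_mul (f g : Fn A) : dzFn δ (f * g) = dzFn δ f * g + f * dzFn δ g := by
  classical
  ext m
  rw [coeff_dzFn, map_add, MvPowerSeries.coeff_mul, MvPowerSeries.coeff_mul,
    MvPowerSeries.coeff_mul, map_sum, ← Finset.sum_add_distrib]
  refine Finset.sum_congr rfl fun p _ => ?_
  rw [Derivation.leibniz, coeff_dzFn, coeff_dzFn, smul_eq_mul, smul_eq_mul]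
  ring

theorem dzFn_pderiv (k : ℕ) (f : Fn A) : dzFn δ (pderiv A k f) = pderiv A k (dzFn δ f) := by
  ext m
  rw [coeff_dzFn, coeff_pderiv, coeff_pderiv, coeff_dzFn, Derivation.leibniz]
  have : δ ((m k : A) + 1) = 0 := by rw [map_add, Derivation.map_natCast, Derivation.map_one_eq_zero,
    add_zero]
  rw [this, smul_zero, zero_add, smul_eq_mul, mul_comm]

@[simp] theorem coeff_dz (P : PDO A) (i : ℤ) : (P.dz δ).coeff i = dzFn δ (P.coeff i) := rfl

theorem dz_mul (P Q : PDO A) : (P * Q).dz δ = P.dz δ * Q + P * Q.dz δ :=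
  mapFn_mul (D := dzFn δ) (dzFn_mul δ) (dzFn_pderiv δ 0) P Q

theorem dz_add (P Q : PDO A) : (P + Q).dz δ = P.dz δ + Q.dz δ :=
  ext' fun _ => map_add (dzFn δ) _ _

theorem dz_sub (P Q : PDO A) : (P - Q).dz δ = P.dz δ - Q.dz δ :=
  ext' fun _ => map_sub (dzFn δ) _ _

theorem dzFn_one : dzFn δ (1 : Fn A) = 0 := by
  have h := dzFn_mul δ 1 1
  rw [mul_one, mul_one, one_mul] at h
  exact left_eq_add.mp h

theorem dz_monoOne (j : ℤ) : (mono 1 j : PDO A).dz δ = 0 := ext' fun i => by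
  rw [coeff_dz, coeff_mono]
  split_ifs
  · exact dzFn_one δ
  · exact map_zero _

theorem dz_del : (del : PDO A).dz δ = 0 := dz_monoOne δ 1

theorem dz_one : (1 : PDO A).dz δ = 0 := dz_monoOne δ 0

theorem OrdLE.dz {P : PDO A} {N : ℤ} (hP : OrdLE P N) : OrdLE (P.dz δ) N :=
  fun i hi => by rw [coeff_dz, hP i hi, map_zero]

theorem negPart_dz (P : PDO A) : (P.dz δ).negPart = P.negPart.dz δ := ext' fun i => by
  rw [coeff_dz, coeff_negPart, coeff_negPart]
  split_ifs
  · rfl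
  · exact (map_zero _).symm

theorem dz_dt (k : ℕ) (P : PDO A) : (P.dt k).dz δ = (P.dz δ).dt k :=
  ext' fun i => dzFn_pderiv δ k (P.coeff i)

theorem dz_adj (P : PDO A) : P.adj.dz δ = (P.dz δ).adj := ext' fun m => by
  obtain ⟨N, hN⟩ := P.exists_ordLE
  have h : ∀ l f, dzFn δ (dxIter l f) = dxIter l (dzFn δ f) := by
    intro l
    induction l with
    | zero => intro f; rfl
    | succ l ih => intro f; rw [dxIter_succ, ih, dx, dzFn_pderiv, ← dx, ← dxIter_succ]
  rw [coeff_dz, coeff_adj_eq_sum hN m (N - m).toNat (by omega),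
    coeff_adj_eq_sum (hN.dz δ) m (N - m).toNat (by omega), map_sum]
  exact Finset.sum_congr rfl fun l _ => by rw [map_zsmul, map_zsmul, h, coeff_dz]

end derivations

/-! ### Limits and inverses of operators. -/

section limits

/-- The coefficient of ∂ᵐ no longer changes from stage -m on, so it can be read off there. -/
theorem exists_limit (s : ℕ → PDO A) (h : ∀ n : ℕ, OrdLE (s (n + 1) - s n) (-(n + 1 : ℕ))) :
    ∃ W : PDO A, ∀ n : ℕ, OrdLE (W - s n) (-(n + 1 : ℕ)) := by
  have hs : ∀ n k : ℕ, OrdLE (s (n + k) - s n) (-(n + 1 : ℕ)) := by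
    intro n k
    induction k with
    | zero => rw [add_zero, sub_self]; exact ordLE_zero _
    | succ k ih =>
      have := ((h (n + k)).mono_bound (M := -(n + 1 : ℕ)) (by push_cast; omega)).add ih
      rwa [sub_add_sub_cancel] at this
  obtain ⟨N, hN⟩ := (s 0).exists_ordLE
  refine ⟨⟨fun m => (s (-m).toNat).coeff m, max N 0, fun m hm => ?_⟩, fun n m hm => ?_⟩
  · rw [show (-m).toNat = 0 by omega]
    exact hN m (by omega)
  · rw [coeff_sub, sub_eq_zero]
    change (s (-m).toNat).coeff m = _
    rcases le_total n (-m).toNat with h1 | h1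
    · obtain ⟨k, hk⟩ := Nat.exists_eq_add_of_le h1
      rw [hk]
      exact sub_eq_zero.mp (hs n k m hm)
    · obtain ⟨k, hk⟩ := Nat.exists_eq_add_of_le h1
      have := sub_eq_zero.mp (hs (-m).toNat k m (by omega))
      rw [← hk] at this
      exact this.symm

/-- Neumann series: the iteration S ↦ S + (1 - W S) multiplies the error 1 - W S by 1 - W, which
lowers its order by at least one each time. -/
theorem exists_rightInverse {W : PDO A} (hW : OrdLE (W - 1) (-1)) :
    ∃ V : PDO A, OrdLE (V - 1) (-1) ∧ W * V = 1 := by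
  let s : ℕ → PDO A := fun n => Nat.rec 1 (fun _ S => S + (1 - W * S)) n
  have hs : ∀ n, s (n + 1) = s n + (1 - W * s n) := fun n => rfl
  have hW' : OrdLE (1 - W) (-1) := by rw [← neg_sub]; exact hW.neg
  have herr : ∀ n : ℕ, OrdLE (1 - W * s n) (-(n + 1 : ℕ)) := by
    intro n
    induction n with
    | zero => simpa [s] using hW'
    | succ n ih =>
      have : 1 - W * s (n + 1) = (1 - W) * (1 - W * s n) := by rw [hs]; noncomm_ring
      rw [this]
      exact (hW'.mul ih).mono_bound (by push_cast; omega)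
  obtain ⟨V, hV⟩ := exists_limit s fun n => by rw [hs, add_sub_cancel_left]; exact herr n
  have hW0 : OrdLE W 0 := by
    have := (hW.mono_bound (M := 0) (by norm_num)).add ordLE_one
    rwa [sub_add_cancel] at this
  refine ⟨V, by simpa [s] using hV 0, ?_⟩
  refine sub_eq_zero.mp (eq_zero_of_forall_ordLE fun n => ?_)
  have : W * V - 1 = W * (V - s n) - (1 - W * s n) := by noncomm_ring
  rw [this]
  exact ((hW0.mul (hV n)).mono_bound (by push_cast; omega)).sub
    ((herr n).mono_bound (by push_cast; omega))

theorem exists_inverse {W : PDO A} (hW : OrdLE (W - 1) (-1)) :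
    ∃ V : PDO A, W * V = 1 ∧ V * W = 1 := by
  obtain ⟨V, hV, h1⟩ := exists_rightInverse hW
  obtain ⟨U, _, h2⟩ := exists_rightInverse hV
  -- The right inverse `V` has a right inverse `U` in turn, so `V` is two-sided.
  have : U = W := by rw [← one_mul U, ← h1, mul_assoc, h2, mul_one]
  exact ⟨V, h1, this ▸ h2⟩

end limits

end PDO

end BKP

namespace BKP

/-! ### Coefficientwise maps and renaming of variables. -/

section coefficientwise

variable {σ R S : Type*} [CommRing R] [CommRing S]

@[simp] theorem coeff_mapCoeff (g : R → S) (f : MvPowerSeries σ R) (m : σ →₀ ℕ) :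
    coeff m (mapCoeff g f) = g (coeff m f) := rfl

theorem pderiv_mapCoeff (g : R →+ S) (i : σ) (f : MvPowerSeries σ R) :
    pderiv S i (mapCoeff g f) = mapCoeff g (pderiv R i f) := by
  ext m
  rw [coeff_pderiv, coeff_mapCoeff, coeff_mapCoeff, coeff_pderiv, ← Nat.cast_succ, ← Nat.cast_succ,
    mul_comm, ← nsmul_eq_mul, mul_comm, ← nsmul_eq_mul, map_nsmul]

theorem mapCoeff_add (g : R →+ S) (f h : MvPowerSeries σ R) :
    mapCoeff g (f + h) = mapCoeff g f + mapCoeff g h := by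
  ext m; simp

theorem rename_mapCoeff {τ : Type*} (e : σ → τ) [Filter.TendstoCofinite e] (g : R →+ S)
    (f : MvPowerSeries σ R) : rename e (mapCoeff g f) = mapCoeff g (rename e f) := by
  ext m
  rw [coeff_rename, coeff_mapCoeff, coeff_rename, map_sum]
  rfl

/-- Chain rule for renaming variables; `s` is the fibre of the renaming map over `j`. -/
theorem pderiv_rename {τ : Type*} (e : σ → τ) [Filter.TendstoCofinite e] (j : τ)
    (s : Finset σ) (hs : ∀ i, i ∈ s ↔ e i = j) (f : MvPowerSeries σ R) :
    pderiv R j (rename e f) = ∑ i ∈ s, rename e (pderiv R i f) := by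
  classical
  ext m
  have hcount : ∀ d : σ →₀ ℕ, Finsupp.mapDomain e d j = ∑ i ∈ s, d i := by
    intro d
    rw [Finsupp.mapDomain, Finsupp.sum_apply, Finsupp.sum]
    simp only [Finsupp.single_apply]
    rw [← Finset.sum_filter]
    refine Finset.sum_subset_zero_on_sdiff ?_ ?_ fun _ _ => rfl
    · intro i hi
      exact (hs i).mpr (Finset.mem_filter.mp hi).2
    · intro i hi
      rw [Finset.mem_sdiff, Finset.mem_filter, not_and] at hi
      by_contra h
      exact hi.2 (Finsupp.mem_support_iff.mpr h) ((hs i).mp hi.1)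
  rw [coeff_pderiv, map_sum, coeff_rename, Finset.sum_mul]
  have h1 : ∀ d ∈ (Filter.TendstoCofinite.finite_preimage_singleton (Finsupp.mapDomain e)
      (m + Finsupp.single j 1)).toFinset, coeff d f * ((m j : R) + 1) =
      ∑ i ∈ s, coeff d f * (d i : R) := by
    intro d hd
    rw [Set.Finite.mem_toFinset, Set.mem_preimage, Set.mem_singleton_iff] at hd
    rw [← Finset.mul_sum, ← Nat.cast_sum, ← hcount, hd, Finsupp.add_apply, Finsupp.single_eq_same,
      Nat.cast_succ]
  rw [Finset.sum_congr rfl h1, Finset.sum_comm]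
  refine Finset.sum_congr rfl fun i hi => ?_
  rw [coeff_rename]
  symm
  -- Differentiation in the variable `i` matches d with d + eᵢ. The exponents with d i = 0 are not
  -- reached, but their terms vanish.
  refine Finset.sum_bij_ne_zero (fun d _ _ => d + Finsupp.single i 1) ?_ ?_ ?_ ?_
  · intro d hd _
    rw [Set.Finite.mem_toFinset, Set.mem_preimage, Set.mem_singleton_iff] at hd ⊢
    rw [Finsupp.mapDomain_add, hd, Finsupp.mapDomain_single, (hs i).mp hi]
  · intro d _ _ d' _ _ h
    exact add_right_cancel h
  · intro d hd hne
    rw [Set.Finite.mem_toFinset, Set.mem_preimage, Set.mem_singleton_iff] at hd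
    have hdi : d i ≠ 0 := fun h => hne (by rw [h, Nat.cast_zero, mul_zero])
    have hle : Finsupp.single i 1 ≤ d := by
      rw [Finsupp.single_le_iff]; omega
    refine ⟨d - Finsupp.single i 1, ?_, ?_, tsub_add_cancel_of_le hle⟩
    · rw [Set.Finite.mem_toFinset, Set.mem_preimage, Set.mem_singleton_iff]
      have := congrArg (Finsupp.mapDomain e) (tsub_add_cancel_of_le hle)
      rw [Finsupp.mapDomain_add, hd, Finsupp.mapDomain_single, (hs i).mp hi] at this
      exact add_right_cancel this
    · rw [coeff_pderiv, tsub_add_cancel_of_le hle, Finsupp.tsub_apply, Finsupp.single_eq_same,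
        ← Nat.cast_succ, Nat.succ_eq_add_one, Nat.sub_add_cancel (by omega)]
      exact hne
  · intro d _ _
    rw [coeff_pderiv, Finsupp.add_apply, Finsupp.single_eq_same, Nat.cast_succ]

end coefficientwise

/-! ### Series in (t, t') and restriction to the diagonal. -/

section doubling

variable {R : Type*} [CommRing R]

instance : Filter.TendstoCofinite (Sum.inl : ℕ → ℕ ⊕ ℕ) :=
  Filter.tendstoCofinite_of_injective Sum.inl_injective

instance : Filter.TendstoCofinite (Sum.inr : ℕ → ℕ ⊕ ℕ) :=
  Filter.tendstoCofinite_of_injective Sum.inr_injective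

instance : Filter.TendstoCofinite (Sum.elim id id : ℕ ⊕ ℕ → ℕ) := by
  rw [Filter.tendstoCofinite_iff_finite_preimage_singleton]
  intro k
  refine (Set.toFinite {Sum.inl k, Sum.inr k}).subset ?_
  rintro (i | i) h <;> simp_all

/-- Restriction to the diagonal `t' = t`. -/
def diag : MvPowerSeries (ℕ ⊕ ℕ) R →ₐ[R] MvPowerSeries ℕ R := rename (Sum.elim id id)

theorem unprimed_eq (f : MvPowerSeries ℕ R) : unprimed f = rename Sum.inl f := rfl

theorem primed_eq (f : MvPowerSeries ℕ R) : primed f = rename Sum.inr f := rfl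

theorem unprimed_add (f g : MvPowerSeries ℕ R) : unprimed (f + g) = unprimed f + unprimed g :=
  map_add _ _ _

theorem unprimed_mul (f g : MvPowerSeries ℕ R) : unprimed (f * g) = unprimed f * unprimed g :=
  map_mul _ _ _

theorem unprimed_one : unprimed (1 : MvPowerSeries ℕ R) = 1 := map_one _

theorem primed_add (f g : MvPowerSeries ℕ R) : primed (f + g) = primed f + primed g :=
  map_add _ _ _

theorem diag_unprimed (f : MvPowerSeries ℕ R) : diag (unprimed f) = f := by
  rw [diag, unprimed_eq, rename_rename]
  exact rename_id_apply f

theorem diag_primed (f : MvPowerSeries ℕ R) : diag (primed f) = f := by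
  rw [diag, primed_eq, rename_rename]
  exact rename_id_apply f

theorem unprimed_injective : Function.Injective (unprimed (B := R)) :=
  Function.LeftInverse.injective diag_unprimed

theorem pderiv_diag (k : ℕ) (F : MvPowerSeries (ℕ ⊕ ℕ) R) :
    pderiv R k (diag F) = diag (pderiv R (Sum.inl k) F) + diag (pderiv R (Sum.inr k) F) := by
  rw [diag, pderiv_rename _ k {Sum.inl k, Sum.inr k} (by rintro (i | i) <;> simp),
    Finset.sum_pair (by simp)]

theorem pderiv_inl_unprimed (k : ℕ) (f : MvPowerSeries ℕ R) :
    pderiv R (Sum.inl k) (unprimed f) = unprimed (pderiv R k f) := by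
  rw [unprimed_eq, pderiv_rename _ (Sum.inl k) {k} (by simp), Finset.sum_singleton, unprimed_eq]

theorem pderiv_inl_primed (k : ℕ) (f : MvPowerSeries ℕ R) :
    pderiv R (Sum.inl k) (primed f) = 0 := by
  rw [primed_eq, pderiv_rename _ (Sum.inl k) ∅ (by simp), Finset.sum_empty]

end doubling

/-! ### Uniqueness from Taylor coefficients on the diagonal. -/

section taylor

variable {A : Type*} [CommRing A]

/-- Taylor's formula: up to a nonzero integer, a coefficient is the constant term of an iterated
derivative. The induction on degree removes one variable at a time. -/
theorem eq_zero_of_constantCoeff [Algebra ℚ A] {σ : Type*} {T : Set (MvPowerSeries σ A)}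
    (hd : ∀ G ∈ T, ∀ i, pderiv A i G ∈ T) (h0 : ∀ G ∈ T, constantCoeff G = 0) :
    ∀ G ∈ T, G = 0 := by
  classical
  have := IsAddTorsionFree.of_module_rat A
  have key : ∀ (n : ℕ) (d : σ →₀ ℕ), d.degree = n → ∀ G ∈ T, coeff d G = 0 := by
    intro n
    induction n with
    | zero =>
      intro d hd0 G hG
      rw [Finsupp.degree_eq_zero_iff] at hd0
      rw [hd0, coeff_zero_eq_constantCoeff]
      exact h0 G hG
    | succ n ih =>
      intro d hdn G hG
      have hd0 : d ≠ 0 := fun h => by rw [h, map_zero] at hdn; omega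
      obtain ⟨i, hi : d i ≠ 0⟩ := DFunLike.ne_iff.mp hd0
      have hle : Finsupp.single i 1 ≤ d := by rw [Finsupp.single_le_iff]; omega
      obtain ⟨d', rfl⟩ := exists_add_of_le hle
      rw [add_comm, map_add, Finsupp.degree_single, Nat.add_right_cancel_iff] at hdn
      have h1 := ih d' hdn _ (hd G hG i)
      rw [coeff_pderiv, ← Nat.cast_succ, mul_comm, ← nsmul_eq_mul, smul_eq_zero_iff_right
        (Nat.succ_ne_zero _)] at h1
      rwa [add_comm]
  intro G hG
  ext d
  exact key _ d rfl G hG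

/-- A set of series in `(t, t')` that is stable under `∂/∂tₙ` for all `n` and vanishes on the
diagonal consists of zero only. -/
theorem eq_zero_of_diag [Algebra ℚ A] {T : Set (MvPowerSeries (ℕ ⊕ ℕ) A)}
    (hd : ∀ G ∈ T, ∀ k, pderiv A (Sum.inl k) G ∈ T) (h0 : ∀ G ∈ T, diag G = 0) :
    ∀ G ∈ T, G = 0 := by
  let iter : List ℕ → MvPowerSeries (ℕ ⊕ ℕ) A → MvPowerSeries (ℕ ⊕ ℕ) A :=
    fun l G => l.foldr (fun k F => pderiv A (Sum.inr k) F) G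
  have hcomm : ∀ l k G, pderiv A (Sum.inl k) (iter l G) = iter l (pderiv A (Sum.inl k) G) := by
    intro l k G
    induction l with
    | nil => rfl
    | cons a l ih =>
      change pderiv A (Sum.inl k) (pderiv A (Sum.inr a) (iter l G)) = _
      rw [PDO.pderiv_comm, ih]
      rfl
  -- By the chain rule a derivative along the diagonal is the sum of the t- and t'-derivatives. The
  -- former stay in `T`, so the t'-derivatives vanish on the diagonal too.
  have hdiag : ∀ l, ∀ G ∈ T, diag (iter l G) = 0 := by
    intro l
    induction l with
    | nil => exact h0
    | cons a l ih =>
      intro G hG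
      change diag (pderiv A (Sum.inr a) (iter l G)) = 0
      have h1 := pderiv_diag a (iter l G)
      rwa [ih G hG, map_zero, hcomm, ih _ (hd G hG a), zero_add, eq_comm] at h1
  intro G hG
  refine eq_zero_of_constantCoeff (T := {F | ∃ l, ∃ G ∈ T, F = iter l G}) ?_ ?_ G ⟨[], G, hG, rfl⟩
  · rintro _ ⟨l, G, hG, rfl⟩ (k | k)
    · exact ⟨l, _, hd G hG k, hcomm l k G⟩
    · exact ⟨k :: l, G, hG, rfl⟩
  · rintro _ ⟨l, G, hG, rfl⟩
    rw [← constantCoeff_rename (Sum.elim id id) (iter l G)]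
    exact (congrArg constantCoeff (hdiag l G hG)).trans (map_zero _)

/-- The span, over functions of `t`, of the `x`-derivatives of `F`. -/
def xSpan (F : MvPowerSeries (ℕ ⊕ ℕ) A) : AddSubgroup (MvPowerSeries (ℕ ⊕ ℕ) A) :=
  AddSubgroup.closure {G | ∃ (a : Fn A) (i : ℕ), G = unprimed a * (pderiv A (Sum.inl 0))^[i] F}

theorem mem_xSpan (F : MvPowerSeries (ℕ ⊕ ℕ) A) (a : Fn A) (i : ℕ) :
    unprimed a * (pderiv A (Sum.inl 0))^[i] F ∈ xSpan F :=
  AddSubgroup.subset_closure ⟨a, i, rfl⟩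

theorem unprimed_mul_mem_xSpan {F G : MvPowerSeries (ℕ ⊕ ℕ) A} (a : Fn A) (hG : G ∈ xSpan F) :
    unprimed a * G ∈ xSpan F := by
  induction hG using AddSubgroup.closure_induction with
  | mem G h =>
    obtain ⟨b, i, rfl⟩ := h
    rw [← mul_assoc, ← unprimed_mul]
    exact mem_xSpan F _ i
  | zero => rw [mul_zero]; exact zero_mem _
  | add _ _ _ _ h1 h2 => rw [mul_add]; exact add_mem h1 h2
  | neg _ _ h => rw [mul_neg]; exact neg_mem h

theorem pderiv_unprimed_mul (k : ℕ) (a : Fn A) (G : MvPowerSeries (ℕ ⊕ ℕ) A) :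
    pderiv A (Sum.inl k) (unprimed a * G) =
      unprimed a * pderiv A (Sum.inl k) G + unprimed (pderiv A k a) * G := by
  rw [Derivation.leibniz, pderiv_inl_unprimed, smul_eq_mul, smul_eq_mul, mul_comm G]

theorem dx_mem_xSpan {F G : MvPowerSeries (ℕ ⊕ ℕ) A} (hG : G ∈ xSpan F) :
    pderiv A (Sum.inl 0) G ∈ xSpan F := by
  induction hG using AddSubgroup.closure_induction with
  | mem G h =>
    obtain ⟨b, i, rfl⟩ := h
    rw [pderiv_unprimed_mul, ← Function.iterate_succ_apply' (pderiv A (Sum.inl 0))]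
    exact add_mem (mem_xSpan F _ _) (mem_xSpan F _ _)
  | zero => rw [map_zero]; exact zero_mem _
  | add _ _ _ _ h1 h2 => rw [map_add]; exact add_mem h1 h2
  | neg _ _ h => rw [map_neg]; exact neg_mem h

/-- The time derivatives commute with ∂ₓ and differentiate the coefficients, so the hypothesis on
`F` alone propagates to its whole span. -/
theorem pderiv_mem_xSpan {F : MvPowerSeries (ℕ ⊕ ℕ) A}
    (hF : ∀ k, pderiv A (Sum.inl k) F ∈ xSpan F) {G : MvPowerSeries (ℕ ⊕ ℕ) A} (hG : G ∈ xSpan F)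
    (k : ℕ) : pderiv A (Sum.inl k) G ∈ xSpan F := by
  induction hG using AddSubgroup.closure_induction with
  | mem G h =>
    obtain ⟨b, i, rfl⟩ := h
    rw [pderiv_unprimed_mul]
    refine add_mem (unprimed_mul_mem_xSpan b ?_) (mem_xSpan F _ _)
    induction i with
    | zero => exact hF k
    | succ i ih =>
      rw [Function.iterate_succ_apply', PDO.pderiv_comm]
      exact dx_mem_xSpan ih
  | zero => rw [map_zero]; exact zero_mem _
  | add _ _ _ _ h1 h2 => rw [map_add]; exact add_mem h1 h2
  | neg _ _ h => rw [map_neg]; exact neg_mem h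

/-- If every `∂F/∂tₙ` is a differential operator in `x` applied to `F` and all `x`-derivatives of
`F` vanish on the diagonal, then `F = 0`. -/
theorem eq_zero_of_evolution [Algebra ℚ A] {F : MvPowerSeries (ℕ ⊕ ℕ) A}
    (hF : ∀ k, pderiv A (Sum.inl k) F ∈ xSpan F)
    (h0 : ∀ i, diag ((pderiv A (Sum.inl 0))^[i] F) = 0) : F = 0 := by
  refine eq_zero_of_diag (T := xSpan F) (fun G hG k => pderiv_mem_xSpan hF hG k) ?_ F ?_
  · intro G hG
    induction hG using AddSubgroup.closure_induction with
    | mem G h =>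
      obtain ⟨b, i, rfl⟩ := h
      rw [map_mul, h0, mul_zero]
    | zero => rw [map_zero]
    | add _ _ _ _ h1 h2 => rw [map_add, h1, h2, add_zero]
    | neg _ _ h => rw [map_neg, h, neg_zero]
  · have := mem_xSpan F 1 0
    rwa [unprimed_one, one_mul] at this

end taylor

/-! ### Laurent series in λ⁻¹ and symbols of operators. -/

section laurent

variable {A : Type*} [CommRing A]

/-- The coefficient of `λ⁻ⁿ` as an additive homomorphism. -/
def lauCoeff (n : ℤ) : Lau A →+ A where
  toFun f := f.coeff n
  map_zero' := rfl
  map_add' _ _ := rfl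

@[simp] theorem coeff_flip (f : Lau A) (n : ℤ) :
    (flip f).coeff n = ((Int.negOnePow n : ℤˣ) : ℤ) • f.coeff n := rfl

/-- The substitution `λ ↦ -λ` as an additive homomorphism. -/
def flipHom : Lau A →+ Lau A where
  toFun := flip
  map_zero' := by ext n; simp
  map_add' f g := by ext n; simp

theorem flip_single (n : ℤ) (r : A) : flip (HahnSeries.single n r) =
    HahnSeries.single n (((Int.negOnePow n : ℤˣ) : ℤ) • r) := by
  ext i
  rw [coeff_flip]
  rcases eq_or_ne i n with rfl | hi
  · rw [HahnSeries.coeff_single_same, HahnSeries.coeff_single_same]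
  · rw [HahnSeries.coeff_single_of_ne hi, HahnSeries.coeff_single_of_ne hi, smul_zero]

theorem flip_mul_single (f : Lau A) (n : ℤ) (r : A) : flip (f * HahnSeries.single n r) =
    flip f * flip (HahnSeries.single n r) := by
  ext i
  rw [flip_single, coeff_flip, HahnSeries.coeff_mul_single, HahnSeries.coeff_mul_single, coeff_flip,
    smul_mul_smul_comm, ← Units.val_mul, ← Int.negOnePow_add, sub_add_cancel]

/-- A function of `t` as a series with constant coefficients in `λ`. -/
def constLam {σ : Type*} : MvPowerSeries σ A →+* MvPowerSeries σ (Lau A) :=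
  MvPowerSeries.map HahnSeries.C

theorem mapCoeff_lauCoeff_constLam_mul {σ : Type*} (a : MvPowerSeries σ A)
    (F : MvPowerSeries σ (Lau A)) (n : ℤ) :
    mapCoeff (lauCoeff n) (constLam a * F) = a * mapCoeff (lauCoeff n) F := by
  classical
  ext m
  rw [coeff_mapCoeff, MvPowerSeries.coeff_mul, MvPowerSeries.coeff_mul, map_sum]
  refine Finset.sum_congr rfl fun p _ => ?_
  rw [constLam, MvPowerSeries.coeff_map, HahnSeries.C_mul_eq_smul]
  rfl

theorem mapCoeff_flip_constLam_mul {σ : Type*} (a : MvPowerSeries σ A)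
    (F : MvPowerSeries σ (Lau A)) :
    mapCoeff flipHom (constLam a * F) = constLam a * mapCoeff flipHom F := by
  classical
  ext m : 1
  rw [coeff_mapCoeff, MvPowerSeries.coeff_mul, MvPowerSeries.coeff_mul, map_sum]
  refine Finset.sum_congr rfl fun p _ => ?_
  rw [constLam, MvPowerSeries.coeff_map, HahnSeries.C_mul_eq_smul, HahnSeries.C_mul_eq_smul]
  ext n
  exact (mul_smul_comm _ _ _).symm

theorem mapCoeff_lauCoeff_C_single_mul {σ : Type*} (j : ℤ) (F : MvPowerSeries σ (Lau A)) (n : ℤ) :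
    mapCoeff (lauCoeff n) (C (HahnSeries.single j (1 : A)) * F) = mapCoeff (lauCoeff (n - j)) F := by
  ext m
  rw [coeff_mapCoeff, coeff_mapCoeff, MvPowerSeries.coeff_C_mul]
  exact HahnSeries.coeff_single_mul.trans (one_mul _)

namespace PDO

theorem coeff_symbol (P : PDO A) (m : ℕ →₀ ℕ) (n : ℤ) :
    (MvPowerSeries.coeff m P.symbol : Lau A).coeff n = MvPowerSeries.coeff m (P.coeff (-n)) := rfl

theorem dt_zero_add (P : PDO A) : P.dt 0 + P * del = del * P := ext' fun m => by
  rw [coeff_add, coeff_dt, coeff_mul_del, coeff_del_mul]; rfl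

theorem symbol_ext {F G : MvPowerSeries ℕ (Lau A)} (h : ∀ n,
    mapCoeff (lauCoeff n) F = mapCoeff (lauCoeff n) G) : F = G := by
  ext m n
  exact congrArg (MvPowerSeries.coeff m) (h n)

theorem mapCoeff_lauCoeff_symbol (P : PDO A) (n : ℤ) :
    mapCoeff (lauCoeff n) P.symbol = P.coeff (-n) := rfl

theorem symbol_add (P Q : PDO A) : (P + Q).symbol = P.symbol + Q.symbol :=
  symbol_ext fun n => by
    rw [mapCoeff_add]; rfl

theorem symbol_fn_mul (a : Fn A) (P : PDO A) : (fn a * P).symbol = constLam a * P.symbol :=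
  symbol_ext fun n => by
    rw [mapCoeff_lauCoeff_constLam_mul, mapCoeff_lauCoeff_symbol, mapCoeff_lauCoeff_symbol,
      coeff_fn_mul]

theorem symbol_mul_monoOne (P : PDO A) (j : ℤ) :
    (P * mono 1 j).symbol = C (HahnSeries.single (-j) 1) * P.symbol :=
  symbol_ext fun n => by
    rw [mapCoeff_lauCoeff_C_single_mul, mapCoeff_lauCoeff_symbol, mapCoeff_lauCoeff_symbol,
      coeff_mul_monoOne]
    congr 1; ring

theorem symbol_one : (1 : PDO A).symbol = 1 := symbol_ext fun n => by
  classical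
  ext m
  change MvPowerSeries.coeff m ((1 : PDO A).coeff (-n)) =
    (MvPowerSeries.coeff m (1 : MvPowerSeries ℕ (Lau A))).coeff n
  rw [one_def, coeff_mono, MvPowerSeries.coeff_one]
  by_cases hn : n = 0
  · subst hn
    rw [if_pos neg_zero, MvPowerSeries.coeff_one]
    split_ifs
    · rw [HahnSeries.coeff_one, if_pos rfl]
    · rfl
  · rw [if_neg (by omega), map_zero]
    split_ifs
    · rw [HahnSeries.coeff_one, if_neg hn]
    · rfl

theorem pderiv_symbol (k : ℕ) (P : PDO A) : pderiv (Lau A) k P.symbol = (P.dt k).symbol :=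
  symbol_ext fun n => by
    rw [← pderiv_mapCoeff, mapCoeff_lauCoeff_symbol, mapCoeff_lauCoeff_symbol, coeff_dt]

end PDO

end laurent

/-! ### Wave functions and the residue pairing. -/

section waves

variable {A : Type*} [CommRing A] [Algebra ℚ A]

theorem coeff_expXi (m : ℕ →₀ ℕ) : coeff m (expXi A) =
    HahnSeries.single (-(m.sum fun k e => ((2 * k + 1) * e : ℤ)))
      (algebraMap ℚ A (m.prod fun _ e => (e.factorial : ℚ)⁻¹)) := rfl

theorem pderiv_expXi (k : ℕ) : pderiv (Lau A) k (expXi A) =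
    C (HahnSeries.single (-(2 * k + 1 : ℤ)) 1) * expXi A := by
  classical
  ext m : 1
  rw [coeff_pderiv, MvPowerSeries.coeff_C_mul, coeff_expXi, coeff_expXi, HahnSeries.single_mul_single,
    Finsupp.sum_add_index' (by simp) (by intros; push_cast; ring), Finsupp.sum_single_index (by simp),
    one_mul, ← Nat.cast_succ, mul_comm, ← nsmul_eq_mul]
  refine (map_nsmul (HahnSeries.single.addMonoidHom _) _ _).symm.trans ?_
  change HahnSeries.single _ _ = _
  -- The factor mₖ + 1 produced by the derivative cancels one factor of (mₖ + 1)!.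
  have hfac : ((m k).succ : ℚ) * ((m + Finsupp.single k 1).prod fun _ e => (e.factorial : ℚ)⁻¹) =
      m.prod fun _ e => (e.factorial : ℚ)⁻¹ := by
    have h1 : ∀ d : ℕ →₀ ℕ, d.support ⊆ (m + Finsupp.single k 1).support →
        (d.prod fun _ e => (e.factorial : ℚ)⁻¹) = ((d k).factorial : ℚ)⁻¹ *
          ∏ i ∈ (m + Finsupp.single k 1).support.erase k, ((d i).factorial : ℚ)⁻¹ := by
      intro d hd
      rw [Finsupp.prod_of_support_subset d hd _ (by simp)]
      exact (Finset.mul_prod_erase _ (fun i => ((d i).factorial : ℚ)⁻¹) (by simp)).symm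
    rw [h1 _ subset_rfl, h1 m (fun i hi => by simp_all), ← mul_assoc]
    congr 1
    · rw [Finsupp.add_apply, Finsupp.single_eq_same, Nat.factorial_succ, Nat.cast_mul, mul_inv,
        ← mul_assoc, mul_inv_cancel₀ (by positivity), one_mul]
    · refine Finset.prod_congr rfl fun i hi => ?_
      rw [Finsupp.add_apply, Finsupp.single_eq_of_ne (Finset.ne_of_mem_erase hi), add_zero]
  congr 1
  · push_cast; ring_nf
  · rw [← hfac, map_mul, map_natCast, nsmul_eq_mul]

theorem mapCoeff_flip_mul_expXi (F : MvPowerSeries ℕ (Lau A)) :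
    mapCoeff flipHom (F * expXi A) = mapCoeff flipHom F * mapCoeff flipHom (expXi A) := by
  classical
  ext m : 1
  rw [coeff_mapCoeff, MvPowerSeries.coeff_mul, MvPowerSeries.coeff_mul, map_sum]
  exact Finset.sum_congr rfl fun p _ => flip_mul_single _ _ _

/-- Only odd times occur, so ξ(t, -λ) = -ξ(t, λ). Formally, the product has constant term 1 and its
derivatives cancel, one factor giving λⁿ and the other -λⁿ. -/
theorem expXi_mul_flip : expXi A * mapCoeff flipHom (expXi A) = 1 := by
  have := IsAddTorsionFree.of_module_rat A
  have : IsAddTorsionFree (Lau A) := IsAddTorsionFree.of_module_rat (Lau A)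
  have hflip : ∀ k, pderiv (Lau A) k (mapCoeff flipHom (expXi A)) =
      -(C (HahnSeries.single (-(2 * k + 1 : ℤ)) 1) * mapCoeff flipHom (expXi A)) := by
    intro k
    rw [pderiv_mapCoeff, pderiv_expXi, mapCoeff_flip_mul_expXi, ← neg_mul]
    congr 1
    classical
    ext m : 1
    rw [coeff_mapCoeff, map_neg, coeff_C]
    split_ifs
    · change flip _ = _
      rw [flip_single, Int.negOnePow_neg, Int.negOnePow_two_mul_add_one, Units.val_neg,
        Units.val_one, neg_smul, one_smul, HahnSeries.single_neg]
    · rw [map_zero, neg_zero]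
  refine pderiv.ext (fun k => ?_) ?_
  · rw [Derivation.leibniz, Derivation.map_one_eq_zero, hflip, pderiv_expXi, smul_eq_mul,
      smul_eq_mul]
    ring
  · have h1 : constantCoeff (expXi A) = 1 := by
      rw [← coeff_zero_eq_constantCoeff_apply, coeff_expXi]
      simp
    have h2 : constantCoeff (mapCoeff flipHom (expXi A)) = 1 := by
      rw [← coeff_zero_eq_constantCoeff_apply, coeff_mapCoeff, coeff_zero_eq_constantCoeff, h1]
      change flip (HahnSeries.single 0 1) = _
      rw [flip_single]
      simp
    rw [map_mul, h1, h2, one_mul, map_one]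

namespace PDO

theorem onExp_add (P Q : PDO A) : (P + Q).onExp = P.onExp + Q.onExp := by
  rw [onExp, symbol_add, add_mul]; rfl

theorem onExp_fn_mul (a : Fn A) (P : PDO A) : (fn a * P).onExp = constLam a * P.onExp := by
  rw [onExp, symbol_fn_mul, mul_assoc]; rfl

theorem pderiv_onExp (k : ℕ) (P : PDO A) :
    pderiv (Lau A) k P.onExp = (P.dt k + P * del ^ (2 * k + 1)).onExp := by
  rw [onExp_add, onExp, onExp, onExp, Derivation.leibniz, pderiv_symbol, pderiv_expXi, del_pow,
    symbol_mul_monoOne, smul_eq_mul, smul_eq_mul]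
  push_cast
  ring

end PDO

open PDO

/-- The coefficients of e^ξ are rational, hence annihilated by `δ`. -/
theorem waveZ_eq (δ : Derivation ℚ A A) (W : PDO A) : waveZ δ W = (W.dz δ).onExp := by
  classical
  rw [waveZ, wave, onExp, onExp]
  ext m n
  rw [coeff_mapCoeff, MvPowerSeries.coeff_mul, MvPowerSeries.coeff_mul]
  change δ (lauCoeff n _) = lauCoeff n _
  rw [map_sum, map_sum, map_sum]
  refine Finset.sum_congr rfl fun p _ => ?_
  change δ ((_ * _ : Lau A).coeff n) = (_ * _ : Lau A).coeff n
  rw [coeff_expXi, HahnSeries.coeff_mul_single, HahnSeries.coeff_mul_single, Derivation.leibniz,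
    Derivation.map_algebraMap, smul_zero, zero_add, smul_eq_mul, mul_comm]
  rfl

/-- The residue pairing `res_λ λ⁻¹ P(e^ξ)(t, λ) Q(e^ξ)(t', -λ)`. -/
def pairing (P Q : PDO A) : MvPowerSeries (ℕ ⊕ ℕ) A :=
  res (lamInv * unprimed P.onExp * primed (mapCoeff flip Q.onExp))

theorem pairing_eq (P Q : PDO A) : pairing P Q = mapCoeff (lauCoeff 1)
    (lamInv * unprimed P.onExp * primed (mapCoeff flipHom Q.onExp)) := rfl

theorem pairing_add_left (P P' Q : PDO A) : pairing (P + P') Q = pairing P Q + pairing P' Q := by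
  rw [pairing_eq, onExp_add, unprimed_add, mul_add, add_mul, mapCoeff_add]; rfl

theorem pairing_add_right (P Q Q' : PDO A) : pairing P (Q + Q') = pairing P Q + pairing P Q' := by
  rw [pairing_eq, onExp_add, mapCoeff_add, primed_add, mul_add, mapCoeff_add]; rfl

theorem pairing_fn_mul_left (a : Fn A) (P Q : PDO A) :
    pairing (fn a * P) Q = unprimed a * pairing P Q := by
  rw [pairing_eq, pairing_eq, onExp_fn_mul, unprimed_mul,
    ← mapCoeff_lauCoeff_constLam_mul (unprimed a)]
  have : unprimed (constLam a) = constLam (unprimed a) := rename_map _ _ _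
  rw [this]
  congr 1
  ring

/-- Only the first slot depends on t, and ∂_{tₙ} multiplies e^ξ by λⁿ, which is right composition of
P with ∂ⁿ. -/
theorem pderiv_pairing (k : ℕ) (P Q : PDO A) :
    pderiv A (Sum.inl k) (pairing P Q) = pairing (P.dt k + P * del ^ (2 * k + 1)) Q := by
  rw [pairing_eq, pairing_eq, pderiv_mapCoeff, Derivation.leibniz, pderiv_inl_primed, smul_zero,
    zero_add, Derivation.leibniz, lamInv, pderiv_C, smul_zero, add_zero, pderiv_inl_unprimed,
    pderiv_onExp, smul_eq_mul, smul_eq_mul, mul_comm (primed _)]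

theorem dx_pairing (P Q : PDO A) :
    pderiv A (Sum.inl 0) (pairing P Q) = pairing (del * P) Q := by
  rw [pderiv_pairing, mul_zero, zero_add, pow_one, dt_zero_add]

theorem iterate_dx_pairing (i : ℕ) (P Q : PDO A) :
    (pderiv A (Sum.inl 0))^[i] (pairing P Q) = pairing (del ^ i * P) Q := by
  induction i with
  | zero => rw [pow_zero, one_mul]; rfl
  | succ i ih => rw [Function.iterate_succ_apply', ih, dx_pairing, ← mul_assoc, ← pow_succ']

/-- At t' = t the exponentials cancel, and the factor λ⁻¹ turns the residue into the constant term
in λ. -/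
theorem diag_pairing_eq (P Q : PDO A) : diag (pairing P Q) =
    mapCoeff (lauCoeff 0) (P.symbol * mapCoeff flipHom Q.symbol) := by
  rw [pairing_eq, diag, rename_mapCoeff, ← diag, map_mul, map_mul, diag_unprimed, diag_primed,
    onExp, onExp, mapCoeff_flip_mul_expXi]
  have h : diag (lamInv : MvPowerSeries (ℕ ⊕ ℕ) (Lau A)) = C (HahnSeries.single 1 1) :=
    rename_C _ _
  rw [h, mul_assoc, mapCoeff_lauCoeff_C_single_mul, sub_self, mul_mul_mul_comm, expXi_mul_flip,
    mul_one]

theorem diag_pairing_of_ordLE {P Q : PDO A} {N K : ℤ} (hP : OrdLE P N) (hQ : OrdLE Q K)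
    (hNK : N + K < 0) : diag (pairing P Q) = 0 := by
  classical
  rw [diag_pairing_eq]
  ext m
  rw [coeff_mapCoeff, MvPowerSeries.coeff_mul, map_sum, map_zero]
  refine Finset.sum_eq_zero fun p _ => ?_
  change (_ * _ : Lau A).coeff 0 = 0
  rw [HahnSeries.coeff_mul]
  refine Finset.sum_eq_zero fun x hx => ?_
  have hsum : x.1 + x.2 = 0 := (Finset.mem_antidiagonal.mp hx).2.2
  rcases lt_or_ge N (-x.1) with h1 | h1
  · rw [coeff_symbol, hP _ h1, map_zero, zero_mul]
  · have : (coeff p.2 (mapCoeff flipHom Q.symbol)).coeff x.2 =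
        ((Int.negOnePow x.2 : ℤˣ) : ℤ) • MvPowerSeries.coeff p.2 (Q.coeff (-x.2)) := rfl
    rw [this, hQ (-x.2) (by omega), map_zero, smul_zero, mul_zero]

/-- On the diagonal, the residue pairing is the residue of `P ∂⁻¹ Q*`. -/
theorem diag_pairing (P Q : PDO A) :
    diag (pairing P Q) = (P * delInv * Q.adj).coeff (-1) := by
  obtain ⟨N, hN⟩ := P.exists_ordLE
  let Φ : PDO A →+ Fn A := AddMonoidHom.mk' (fun Q => diag (pairing P Q))
    (fun Q Q' => by rw [pairing_add_right, map_add])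
  -- Both sides are additive in `Q` and vanish when its order is below -N, so only Q = b ∂ʲ has to
  -- be checked.
  have : Φ = ((coeffHom (-1)).comp (AddMonoidHom.mulLeft (P * delInv))).comp adjHom :=
    hom_ext (-N - 1) (fun R hR => diag_pairing_of_ordLE hN hR (by omega))
      (fun R hR => ((hN.mul ordLE_delInv).mul hR.adj) (-1) (by omega)) fun b j => by
    change diag (pairing P (mono b j)) = (P * delInv * (mono b j).adj).coeff (-1)
    have hsym : mapCoeff flipHom (mono b j).symbol =
        constLam b * C (HahnSeries.single (-j) (((Int.negOnePow j : ℤˣ) : ℤ) : A)) := by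
      classical
      rw [mono_eq, symbol_fn_mul, ← one_mul (mono 1 j), symbol_mul_monoOne, symbol_one, mul_one,
        mapCoeff_flip_constLam_mul]
      congr 1
      ext m : 1
      rw [coeff_mapCoeff, coeff_C, coeff_C]
      split_ifs
      · exact (flip_single _ _).trans (by simp)
      · exact map_zero _
    rw [diag_pairing_eq, hsym, adj_mono, mul_smul_comm, coeff_zsmul,
      ← mul_assoc (P * delInv), coeff_mul_fn_neg_one, coeff_mul_monoOne, coeff_mul_delInv, mul_left_comm,
      mapCoeff_lauCoeff_constLam_mul]
    have hsgn : C (HahnSeries.single (-j) (((Int.negOnePow j : ℤˣ) : ℤ) : A)) =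
        ((Int.negOnePow j : ℤˣ) : ℤ) •
          (C (HahnSeries.single (-j) (1 : A)) : MvPowerSeries ℕ (Lau A)) := by
      rw [← map_zsmul, ← zsmul_one]
      exact congrArg _ (map_zsmul (HahnSeries.single.addMonoidHom (-j)) _ (1 : A))
    have hz : ∀ (n : ℤ) (F : MvPowerSeries ℕ (Lau A)),
        mapCoeff (lauCoeff 0) (n • F) = n • mapCoeff (lauCoeff 0) F := fun n F => by
      ext m
      rw [coeff_mapCoeff, map_zsmul, map_zsmul, map_zsmul]
      rfl
    rw [hsgn, mul_smul_comm, hz, mul_comm P.symbol, mapCoeff_lauCoeff_C_single_mul,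
      mapCoeff_lauCoeff_symbol, mul_smul_comm, mul_comm b]
    congr 3
    ring
  exact DFunLike.congr_fun this Q

end waves

end BKP

namespace BKP

open PDO

/-! ### Consequences of the BKP constraint. -/

section lax

variable {A : Type*} [CommRing A]

theorem eq_zero_of_isDiff {P : PDO A} (h1 : IsDiff P) (h2 : OrdLE P (-1)) : P = 0 := by
  rw [← h2.negPart_eq, h1.negPart_eq_zero]

theorem B_eq (L : PDO A) (n : ℕ) : B L n = L ^ n - (L ^ n).negPart := by
  rw [B, pow_eq, pos_eq]

theorem isDiff_B (L : PDO A) (n : ℕ) : IsDiff (B L n) := isDiff_pos _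

/-- Every term with a derivative carries a binomial C(k, k + 1) = 0, so only the sign of (-∂)⁻¹
remains. -/
theorem coeff_adj_neg_one (X : PDO A) : X.adj.coeff (-1) = -X.coeff (-1) := by
  rw [coeff_adj, finsum_eq_single _ 0]
  · simp
  · intro k hk
    obtain ⟨k, rfl⟩ := Nat.exists_eq_succ_of_ne_zero hk
    rw [show (-1 + (k.succ : ℕ) : ℤ) = (k : ℕ) by push_cast; ring, choose_nat_eq_zero (by omega),
      zero_smul, smul_zero]

theorem adj_pow_of_constraint {L : PDO A} (hL : L.adj = -(del * L * delInv)) (k : ℕ) :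
    (L ^ (2 * k + 1)).adj = -(del * L ^ (2 * k + 1) * delInv) := by
  have h : ∀ n : ℕ, (del * L * delInv) ^ n = del * L ^ n * delInv := by
    intro n
    induction n with
    | zero => rw [pow_zero, pow_zero, mul_one, del_mul_delInv]
    | succ n ih => rw [pow_succ, ih, pow_succ]; simp only [mul_assoc, delInv_mul_del_mul]
  rw [adj_pow, hL, Odd.neg_pow ⟨k, rfl⟩, h]

variable [Algebra ℚ A]

theorem fn_eq_zero_of_eq_neg {f : Fn A} (h : f = -f) : f = 0 := by
  have : IsAddTorsionFree (Fn A) := IsAddTorsionFree.of_module_rat _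
  exact self_eq_neg.mp h

/-- For odd n the operator Lⁿ ∂⁻¹ is self-adjoint, while the adjoint changes the sign of the
residue; hence the residue of Lⁿ ∂⁻¹ is zero. -/
theorem coeff_zero_pow_odd {L : PDO A} (hL : L.adj = -(del * L * delInv)) (k : ℕ) :
    (L ^ (2 * k + 1)).coeff 0 = 0 := by
  have h := coeff_adj_neg_one (L ^ (2 * k + 1) * delInv)
  rw [adj_mul, adj_pow_of_constraint hL, adj_delInv, neg_mul_neg, mul_assoc,
    delInv_mul_del_mul, coeff_mul_delInv] at h
  exact fn_eq_zero_of_eq_neg h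

theorem coeff_zero_B {L : PDO A} (hL : L.adj = -(del * L * delInv)) (k : ℕ) :
    (B L (2 * k + 1)).coeff 0 = 0 := by
  rw [B, pow_eq, coeff_pos, if_pos le_rfl, coeff_zero_pow_odd hL]

end lax

/-! ### The ghost operator r ∂⁻¹ q_x - q ∂⁻¹ r_x. -/

section ghost

variable {A : Type*} [CommRing A]

theorem delInv_fn_dx_delInv (q : Fn A) :
    delInv * fn (dx q) * delInv = fn q * delInv - delInv * fn q := by
  rw [fn_dx, mul_sub, sub_mul, delInv_mul_del_mul, mul_assoc delInv, mul_assoc (fn q),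
    del_mul_delInv, mul_one]

/-- Integration by parts, the two terms containing q r ∂⁻¹ cancelling. The result is the operator
matched with the kernel q(t)r(t') - r(t)q(t') of (2b). -/
theorem ghost_mul_delInv (q r : Fn A) :
    ghost q r * delInv = fn q * delInv * fn r - fn r * delInv * fn q := by
  rw [ghost, sub_mul, mul_assoc (fn r), mul_assoc (fn r), delInv_fn_dx_delInv, mul_assoc (fn q),
    mul_assoc (fn q), delInv_fn_dx_delInv, mul_sub, mul_sub, ← mul_assoc, ← mul_assoc,
    fn_mul_comm r q]
  simp only [mul_assoc]
  abel

theorem ordLE_fn_delInv_fn (f g : Fn A) : OrdLE (fn f * delInv * fn g) (-1) :=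
  (((ordLE_fn f).mul ordLE_delInv).mul (ordLE_fn g)).mono_bound (by norm_num)

theorem ordLE_ghost (q r : Fn A) : OrdLE (ghost q r) (-1) :=
  (ordLE_fn_delInv_fn _ _).sub (ordLE_fn_delInv_fn _ _)

end ghost

/-! ### Dressing operators. -/

section dressing

variable {A : Type*} [CommRing A]

/-- `W = 1 + ∑_{i ≥ 1} wᵢ ∂⁻ⁱ`. -/
def IsMonic (W : PDO A) : Prop := OrdLE (W - 1) (-1)

theorem isMonic_iff (W : PDO A) : IsMonic W ↔ W.coeff 0 = 1 ∧ ∀ i, 0 < i → W.coeff i = 0 := by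
  constructor
  · intro h
    refine ⟨?_, fun i hi => ?_⟩
    · have := h 0 (by norm_num)
      rw [coeff_sub, one_def, coeff_mono_self] at this
      exact sub_eq_zero.mp this
    · have := h i (by omega)
      rwa [coeff_sub, one_def, coeff_mono_of_ne _ (by omega), sub_zero] at this
  · rintro ⟨h0, h⟩ i hi
    rw [coeff_sub, one_def, coeff_mono]
    split_ifs with h1
    · rw [h1, h0, sub_self]
    · rw [h i (by omega), sub_zero]

theorem IsMonic.ordLE {W : PDO A} (hW : IsMonic W) : OrdLE W 0 :=
  ((isMonic_iff W).mp hW).2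

theorem IsMonic.dt {W : PDO A} (hW : IsMonic W) (k : ℕ) : OrdLE (W.dt k) (-1) := by
  have := OrdLE.dt hW k
  rwa [dt_sub, dt_one, sub_zero] at this

theorem IsMonic.dz [Algebra ℚ A] {W : PDO A} (hW : IsMonic W) (δ : Derivation ℚ A A) :
    OrdLE (W.dz δ) (-1) := by
  have := OrdLE.dz δ hW
  rwa [dz_sub, dz_one, sub_zero] at this

theorem IsMonic.ordLE_inverse {W V : PDO A} (hW : IsMonic W) (hVW : V * W = 1) : OrdLE V 0 := by
  obtain ⟨U, hU, h⟩ := exists_rightInverse hW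
  have : V = U := by rw [← mul_one V, ← h, ← mul_assoc, hVW, one_mul]
  exact this ▸ IsMonic.ordLE hU

variable {L W V : PDO A}

theorem pow_mul_dressing (h : L * W = W * del) (n : ℕ) : L ^ n * W = W * del ^ n := by
  induction n with
  | zero => rw [pow_zero, pow_zero, one_mul, mul_one]
  | succ n ih => rw [pow_succ, mul_assoc, h, ← mul_assoc, ih, mul_assoc, ← pow_succ]

/-- The Sato equation in linear form: applied to e^ξ it reads w_{tₙ} = Bₙ w. -/
theorem dt_add_eq_B_mul (hLW : L * W = W * del) {k : ℕ}
    (h : W.dt k = -((L ^ (2 * k + 1)).negPart * W)) :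
    W.dt k + W * del ^ (2 * k + 1) = B L (2 * k + 1) * W := by
  rw [h, ← pow_mul_dressing hLW, B_eq, sub_mul]; abel

theorem adj_eq_of_constraint (hWV : W * V = 1) (h : W.adj * del * W = del) :
    W.adj = del * V * delInv := by
  rw [← h, mul_assoc, mul_assoc, mul_assoc, ← mul_assoc W, hWV, one_mul, del_mul_delInv, mul_one]

theorem lax_adj_of_constraint (hWV : W * V = 1) (h : W.adj * del * W = del) :
    (W * del * V).adj = -(del * (W * del * V) * delInv) := by
  have hW := adj_eq_of_constraint hWV h
  have hV : V.adj = del * W * delInv := by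
    have h1 : V.adj * W.adj = 1 := by rw [← adj_mul, hWV, adj_one]
    have h2 : W.adj * (del * W * delInv) = 1 := by
      rw [← mul_assoc, ← mul_assoc, h, del_mul_delInv]
    rw [← one_mul (del * W * delInv), ← h1, mul_assoc, h2, mul_one]
  rw [adj_mul, adj_mul, hW, hV, adj_del]
  simp only [mul_assoc, neg_mul, mul_neg, delInv_mul_del_mul]

end dressing

/-! ### Kernels f(t)g(t') and their operators f ∂⁻¹ g. -/

section action

variable {A : Type*} [CommRing A]

theorem PDO.IsDiff.eq_sum {P : PDO A} (hP : IsDiff P) {T : ℕ} (hT : OrdLE P T) :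
    P = ∑ i ∈ Finset.range (T + 1), fn (P.coeff i) * del ^ i := ext' fun m => by
  have h : ∀ i : ℕ, (fn (P.coeff i) * del ^ i).coeff m = if m = i then P.coeff m else 0 := by
    intro i
    rw [del_pow, ← mono_eq, coeff_mono]
    split_ifs with h
    · rw [h]
    · rfl
  rw [coeff_sum, Finset.sum_congr rfl fun i _ => h i]
  by_cases hm : 0 ≤ m ∧ m ≤ T
  · obtain ⟨n, rfl⟩ := Int.eq_ofNat_of_zero_le hm.1
    rw [Finset.sum_eq_single n (fun i _ hi => if_neg (by omega))
      (fun hn => absurd (Finset.mem_range.mpr (by omega)) hn), if_pos rfl]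
  · rw [Finset.sum_eq_zero fun i hi => if_neg ?_]
    · rcases lt_or_ge m 0 with h1 | h1
      · exact hP m h1
      · exact hT m (by omega)
    · rw [Finset.mem_range] at hi; omega

/-- The action on functions of `(t, t')`, in the variable `x`, of the part of `P` involving
`1, ∂, …, ∂ᵀ`. -/
def actUnprimed (P : PDO A) (T : ℕ) :
    MvPowerSeries (ℕ ⊕ ℕ) A →+ MvPowerSeries (ℕ ⊕ ℕ) A where
  toFun F := ∑ i ∈ Finset.range (T + 1), unprimed (P.coeff i) * (pderiv A (Sum.inl 0))^[i] F
  map_zero' := Finset.sum_eq_zero fun i _ => by rw [iterate_map_zero, mul_zero]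
  map_add' F G := by
    rw [← Finset.sum_add_distrib]
    exact Finset.sum_congr rfl fun i _ => by rw [iterate_map_add, mul_add]

theorem actUnprimed_apply (P : PDO A) (T : ℕ) (F : MvPowerSeries (ℕ ⊕ ℕ) A) :
    actUnprimed P T F =
      ∑ i ∈ Finset.range (T + 1), unprimed (P.coeff i) * (pderiv A (Sum.inl 0))^[i] F := rfl

theorem actUnprimed_mem_xSpan (P : PDO A) (T : ℕ) (F : MvPowerSeries (ℕ ⊕ ℕ) A) :
    actUnprimed P T F ∈ xSpan F := by
  rw [actUnprimed_apply]
  exact AddSubgroup.sum_mem _ fun (i : ℕ) _ => mem_xSpan F (P.coeff (i : ℤ)) i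

theorem iterate_dx_unprimed_mul_primed (f g : Fn A) (i : ℕ) :
    (pderiv A (Sum.inl 0))^[i] (unprimed f * primed g) = unprimed (dxIter i f) * primed g := by
  induction i with
  | zero => rfl
  | succ i ih =>
    rw [Function.iterate_succ_apply', ih, pderiv_unprimed_mul, pderiv_inl_primed, mul_zero,
      zero_add, dxIter_succ']
    rfl

theorem actUnprimed_unprimed_mul_primed {P : PDO A} {T : ℕ} (hT : OrdLE P T) (f g : Fn A) :
    actUnprimed P T (unprimed f * primed g) = unprimed (P.act f) * primed g := by
  rw [act_eq_finset_sum hT f T le_rfl, actUnprimed_apply, unprimed_eq (∑ _ ∈ _, _),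
    map_sum, Finset.sum_mul]
  refine Finset.sum_congr rfl fun i _ => ?_
  rw [iterate_dx_unprimed_mul_primed, ← mul_assoc, map_mul]
  rfl

theorem unprimed_mul_primed_one (f : Fn A) : unprimed f * primed (1 : Fn A) = unprimed f :=
  (congrArg _ (map_one (rename Sum.inr))).trans (mul_one _)

theorem actUnprimed_unprimed {P : PDO A} {T : ℕ} (hT : OrdLE P T) (f : Fn A) :
    actUnprimed P T (unprimed f) = unprimed (P.act f) := by
  have := actUnprimed_unprimed_mul_primed hT f 1
  rwa [unprimed_mul_primed_one, unprimed_mul_primed_one] at this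

theorem act_one (P : PDO A) : P.act 1 = P.coeff 0 := by rw [act_eq, fn_one, mul_one]

theorem residue_del_pow_mul (f g : Fn A) (i : ℕ) :
    (del ^ i * (fn f * delInv * fn g)).coeff (-1) = dxIter i f * g := by
  rw [← mul_assoc, ← mul_assoc, coeff_mul_fn_neg_one, coeff_mul_delInv, neg_add_cancel, ← act_eq,
    del_pow]
  congr 1
  refine (finsum_eq_single _ i fun j hj => ?_).trans ?_
  · rw [coeff_mono_of_ne _ (by omega), zero_mul]
  · rw [coeff_mono_self, one_mul]; rfl

theorem diag_iterate_dx (f g : Fn A) (i : ℕ) :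
    diag ((pderiv A (Sum.inl 0))^[i] (unprimed f * primed g)) =
      (del ^ i * (fn f * delInv * fn g)).coeff (-1) := by
  rw [iterate_dx_unprimed_mul_primed, map_mul, diag_unprimed, diag_primed, residue_del_pow_mul]

theorem diag_iterate_dx_one (i : ℕ) : diag ((pderiv A (Sum.inl 0))^[i] 1) =
    (del ^ i * delInv : PDO A).coeff (-1) := by
  have h := diag_iterate_dx (1 : Fn A) 1 i
  rwa [unprimed_mul_primed_one, unprimed_one, fn_one, one_mul, mul_one] at h

theorem diag_iterate_dx_sub (q r : Fn A) (i : ℕ) :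
    diag ((pderiv A (Sum.inl 0))^[i] (unprimed q * primed r - unprimed r * primed q)) =
      (del ^ i * (fn q * delInv * fn r - fn r * delInv * fn q)).coeff (-1) := by
  rw [iterate_map_sub, map_sub, diag_iterate_dx, diag_iterate_dx, mul_sub, coeff_sub]

/-- The adjoint of ∂⁻¹ q ∂ W is W* ∂ q ∂⁻¹, so the constraint leaves q ∂⁻¹, the operator of the
kernel q(t)·1. This explains the shape of (2c) and (2d). -/
theorem intWave_residue (hW : W * delInv * W.adj = delInv) (q : Fn A) :
    W * delInv * (delInv * fn q * del * W).adj = fn q * delInv := by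
  rw [adj_mul, adj_mul, adj_mul, adj_delInv, adj_fn, adj_del, ← mul_assoc, hW]
  simp only [mul_neg, neg_mul, neg_neg, delInv_mul_del_mul]

variable [Algebra ℚ A]

theorem pairing_diff_mul {P : PDO A} (hP : IsDiff P) {T : ℕ} (hT : OrdLE P T) (Q R : PDO A) :
    pairing (P * Q) R = actUnprimed P T (pairing Q R) := by
  let Φ : PDO A →+ MvPowerSeries (ℕ ⊕ ℕ) A :=
    AddMonoidHom.mk' (fun Q => pairing Q R) (fun Q Q' => pairing_add_left Q Q' R)
  have hΦ : ∀ Q, Φ Q = pairing Q R := fun _ => rfl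
  conv_lhs => rw [hP.eq_sum hT, Finset.sum_mul, ← hΦ, map_sum]
  refine Finset.sum_congr rfl fun i _ => ?_
  rw [hΦ, mul_assoc, pairing_fn_mul_left, iterate_dx_pairing]

theorem diag_iterate_dx_pairing (P Q : PDO A) (i : ℕ) :
    diag ((pderiv A (Sum.inl 0))^[i] (pairing P Q)) =
      (del ^ i * (P * delInv * Q.adj)).coeff (-1) := by
  rw [iterate_dx_pairing, diag_pairing, mul_assoc, mul_assoc, mul_assoc]

theorem isDiff_of_pairing_eq {P Q S : PDO A} {G : MvPowerSeries (ℕ ⊕ ℕ) A} (h : pairing P Q = G)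
    (hG : ∀ i : ℕ, diag ((pderiv A (Sum.inl 0))^[i] G) = (del ^ i * S).coeff (-1)) :
    IsDiff (P * delInv * Q.adj - S) :=
  isDiff_of_forall_residue fun k => by
    rw [mul_sub, coeff_sub, ← diag_iterate_dx_pairing, h, hG, sub_self]

/-- Uniqueness for the linear evolution F_{tₙ} = Dₙ F: its solutions are determined by their
x-derivatives on the diagonal. -/
theorem pairing_eq_of_evolution {P Q : PDO A} {G : MvPowerSeries (ℕ ⊕ ℕ) A} (D : ℕ → PDO A)
    (T : ℕ → ℕ) (hP : ∀ k, pderiv A (Sum.inl k) (pairing P Q) = actUnprimed (D k) (T k) (pairing P Q))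
    (hG : ∀ k, pderiv A (Sum.inl k) G = actUnprimed (D k) (T k) G)
    (hdiag : ∀ i : ℕ, diag ((pderiv A (Sum.inl 0))^[i] G) =
      (del ^ i * (P * delInv * Q.adj)).coeff (-1)) : pairing P Q = G := by
  refine sub_eq_zero.mp (eq_zero_of_evolution (fun k => ?_) fun i => ?_)
  · rw [map_sub, hP, hG, ← map_sub]
    exact actUnprimed_mem_xSpan _ _ _
  · rw [iterate_map_sub, map_sub, diag_iterate_dx_pairing, hdiag, sub_self]

end action

/-! ### Equivalence of the dressed hierarchy and the residue identities. -/

section main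

variable {A : Type*} [CommRing A] [Algebra ℚ A] {δ : Derivation ℚ A A} {L W : PDO A} {q r : Fn A}

theorem IsDressedSolution.residueIdentities (hWL : Dresses W L)
    (h : IsDressedSolution δ L W q r) : ResidueIdentities δ W q r := by
  obtain ⟨-, V, hWV, hVW, rfl⟩ := hWL
  set L := W * del * V
  have hLW : L * W = W * del := by rw [mul_assoc, hVW, mul_one]
  have hadj : L.adj = -(del * L * delInv) := lax_adj_of_constraint hWV h.constraint
  have hB0 := coeff_zero_B hadj
  have hWres : W * delInv * W.adj = delInv := by
    rw [adj_eq_of_constraint hWV h.constraint]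
    simp only [mul_assoc, delInv_mul_del_mul]
    rw [← mul_assoc, hWV, one_mul]
  have hWt : ∀ k, W.dt k + W * del ^ (2 * k + 1) = B L (2 * k + 1) * W := fun k =>
    dt_add_eq_B_mul hLW (by rw [h.sato, pow_eq])
  choose T hT using fun k => show ∃ T : ℕ, OrdLE (B L (2 * k + 1)) T by
    obtain ⟨N, hN⟩ := (B L (2 * k + 1)).exists_ordLE
    exact ⟨N.toNat, hN.mono_bound (by omega)⟩
  have hev : ∀ Q k, pderiv A (Sum.inl k) (pairing W Q) =
      actUnprimed (B L (2 * k + 1)) (T k) (pairing W Q) := fun Q k => by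
    rw [pderiv_pairing, hWt, pairing_diff_mul (isDiff_B _ _) (hT k)]
  have hww : pairing W W = 1 := by
    refine pairing_eq_of_evolution (fun k => B L (2 * k + 1)) T (hev W) (fun k => ?_) fun i => ?_
    · rw [Derivation.map_one_eq_zero, ← unprimed_one, actUnprimed_unprimed (hT k), act_one, hB0]
      exact (map_zero (rename Sum.inl)).symm
    · rw [hWres, diag_iterate_dx_one]
  have hrepr : ∀ f, IsEigenfunction L f → unprimed f = pairing W (delInv * fn f * del * W) := by
    intro f hf
    refine (pairing_eq_of_evolution (fun k => B L (2 * k + 1)) T (hev _) (fun k => ?_) fun i => ?_).symm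
    · rw [pderiv_inl_unprimed, hf k, actUnprimed_unprimed (hT k)]
    · rw [intWave_residue hWres, ← unprimed_mul_primed_one, diag_iterate_dx, fn_one, mul_one]
  refine ⟨hww, ?_, hrepr q h.eigen_q, hrepr r h.eigen_r⟩
  rw [waveZ_eq]
  refine pairing_eq_of_evolution (fun k => B L (2 * k + 1)) T (fun k => ?_) (fun k => ?_) fun i => ?_
  · have hz : (W.dz δ).dt k + W.dz δ * del ^ (2 * k + 1) =
        (B L (2 * k + 1)).dz δ * W + B L (2 * k + 1) * W.dz δ := by
      rw [← dz_mul, ← hWt, dz_add, dz_mul, dz_dt, del_pow, dz_monoOne, mul_zero, add_zero]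
    have hBz : IsDiff ((B L (2 * k + 1)).dz δ) := fun i hi => by
      rw [coeff_dz, isDiff_B L _ i hi, map_zero]
    -- The extra term (Bₙ)_z acts on the pairing of `W` with itself, which is the constant 1, and
    -- (Bₙ)_z(1) = 0 because Bₙ has no zeroth coefficient.
    rw [pderiv_pairing, hz, pairing_add_left, pairing_diff_mul hBz ((hT k).dz δ), hww,
      ← unprimed_one, actUnprimed_unprimed ((hT k).dz δ), act_one, coeff_dz, hB0, map_zero,
      unprimed_eq, map_zero, zero_add, pairing_diff_mul (isDiff_B _ _) (hT k)]
  · rw [map_sub, map_sub, actUnprimed_unprimed_mul_primed (hT k),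
      actUnprimed_unprimed_mul_primed (hT k), ← h.eigen_q k, ← h.eigen_r k, pderiv_unprimed_mul,
      pderiv_unprimed_mul, pderiv_inl_primed, pderiv_inl_primed, mul_zero, mul_zero, zero_add,
      zero_add]
  · rw [diag_iterate_dx_sub, h.ghost_flow, mul_assoc (ghost q r), mul_assoc (ghost q r), hWres,
      ghost_mul_delInv]

theorem ResidueIdentities.isDressedSolution (hWL : Dresses W L)
    (h : ResidueIdentities δ W q r) : IsDressedSolution δ L W q r := by
  obtain ⟨hW, V, hWV, hVW, rfl⟩ := hWL
  set L := W * del * V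
  have hLW : L * W = W * del := by rw [mul_assoc, hVW, mul_one]
  have hmon : IsMonic W := (isMonic_iff W).mpr hW
  have hV0 : OrdLE V 0 := hmon.ordLE_inverse hVW
  have hww : pairing W W = 1 := h.ww
  have hWres : W * delInv * W.adj = delInv := by
    -- The difference is differential by (2a) and of order at most -1, hence zero.
    refine sub_eq_zero.mp (eq_zero_of_isDiff (isDiff_of_pairing_eq hww diag_iterate_dx_one) ?_)
    exact (((hmon.ordLE.mul ordLE_delInv).mul hmon.ordLE.adj).mono_bound (by norm_num)).sub
      ordLE_delInv
  have hVres : delInv * W.adj = V * delInv := by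
    have := congrArg (V * ·) hWres
    simpa only [← mul_assoc, hVW, one_mul] using this
  have hres : ∀ X : PDO A, X * delInv * W.adj = X * V * delInv := fun X => by
    rw [mul_assoc, hVres, mul_assoc]
  have hcon : W.adj * del * W = del := by
    rw [← del_mul_delInv_mul W.adj, hVres, mul_assoc, mul_assoc, mul_assoc, delInv_mul_del_mul,
      hVW, mul_one]
  have hsato : ∀ k, W.dt k = -((L ^ (2 * k + 1)).negPart * W) := by
    intro k
    have h1 : pairing (W.dt k + W * del ^ (2 * k + 1)) W = 0 := by
      rw [← pderiv_pairing, hww, Derivation.map_one_eq_zero]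
    have h2 := isDiff_of_pairing_eq (S := 0) h1 fun i => by
      rw [iterate_map_zero, map_zero, mul_zero, PDO.coeff_zero]
    rw [sub_zero, hres, add_mul, ← pow_mul_dressing hLW, mul_assoc, hWV, mul_one] at h2
    -- The derivative of (2a) makes this operator times ∂⁻¹ differential. Since W_{tₙ} W⁻¹ has order
    -- at most -1, its negative part then yields the Sato equation.
    have h3 : IsDiff (W.dt k * V + L ^ (2 * k + 1)) := fun i hi => by
      have := h2 (i - 1) (by omega)
      rwa [coeff_mul_delInv, sub_add_cancel] at this
    have h4 : OrdLE (W.dt k * V) (-1) := ((hmon.dt k).mul hV0).mono_bound (by norm_num)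
    have h5 := h3.negPart_eq_zero
    rw [negPart_add, h4.negPart_eq] at h5
    rw [← neg_mul, ← eq_neg_of_add_eq_zero_left h5, mul_assoc, hVW, mul_one]
  have heig : ∀ f, unprimed f = pairing W (delInv * fn f * del * W) → IsEigenfunction L f := by
    intro f hf k
    obtain ⟨N, hN⟩ := (B L (2 * k + 1)).exists_ordLE
    have hT : OrdLE (B L (2 * k + 1)) N.toNat := hN.mono_bound (by omega)
    apply unprimed_injective
    rw [← pderiv_inl_unprimed, hf, pderiv_pairing, dt_add_eq_B_mul hLW (hsato k),
      pairing_diff_mul (isDiff_B _ _) hT, ← hf, actUnprimed_unprimed hT]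
  refine ⟨fun k => by rw [pow_eq, hsato], hcon, ?_, heig q h.repr_q, heig r h.repr_r⟩
  have hz : pairing (W.dz δ) W = unprimed q * primed r - unprimed r * primed q := by
    rw [← h.wzw, waveZ_eq]; rfl
  have h1 := isDiff_of_pairing_eq hz (diag_iterate_dx_sub q r)
  have h2 : OrdLE (W.dz δ * delInv * W.adj - (fn q * delInv * fn r - fn r * delInv * fn q)) (-1) :=
    ((((hmon.dz δ).mul ordLE_delInv).mul hmon.ordLE.adj).mono_bound (by norm_num)).sub
      ((ordLE_fn_delInv_fn _ _).sub (ordLE_fn_delInv_fn _ _))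
  have h3 := sub_eq_zero.mp (eq_zero_of_isDiff h1 h2)
  rw [hres, ← ghost_mul_delInv] at h3
  have h4 : W.dz δ * V = ghost q r := by
    have := congrArg (· * del) h3
    simpa only [mul_assoc, delInv_mul_del, mul_one] using this
  rw [← h4, mul_assoc, hVW, mul_one]

theorem IsDressedSolution.isSolution (hWL : Dresses W L) (h : IsDressedSolution δ L W q r) :
    IsSolution δ L q r := by
  obtain ⟨hW, V, hWV, hVW, rfl⟩ := hWL
  have hmon : IsMonic W := (isMonic_iff W).mpr hW
  have hV0 : OrdLE V 0 := hmon.ordLE_inverse hVW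
  have hadj := lax_adj_of_constraint hWV h.constraint
  have hLW : W * del * V * W = W * del := by rw [mul_assoc, hVW, mul_one]
  generalize W * del * V = L at h hadj hLW ⊢
  have hcancel : ∀ X Y : PDO A, X * W = Y * W → X = Y := fun X Y hXY => by
    rw [← mul_one X, ← hWV, ← mul_assoc, hXY, mul_assoc, hWV, mul_one]
  have hform : OrdLE (L - del) (-1) := by
    -- From L W = W ∂ = ∂ W - Wₓ, without any use of the flows.
    have h1 : L - del = -(W.dt 0 * V) := hcancel _ _ (by
      rw [sub_mul, hLW, ← dt_zero_add, neg_mul, mul_assoc, hVW, mul_one]; abel)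
    rw [h1]
    exact (((hmon.dt 0).mul hV0).mono_bound (by norm_num)).neg
  refine ⟨⟨?_, ?_, fun i hi => ?_⟩, fun k => ?_, hadj, ?_,
    h.eigen_q, h.eigen_r⟩
  · have := hform 1 (by norm_num)
    rwa [coeff_sub, del, coeff_mono_self, sub_eq_zero] at this
  · have := hform 0 (by norm_num)
    rwa [coeff_sub, del, coeff_mono_of_ne _ (by norm_num), sub_zero] at this
  · have := hform i (by omega)
    rwa [coeff_sub, del, coeff_mono_of_ne _ (by omega), sub_zero] at this
  · have h1 := congrArg (PDO.dt k) hLW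
    rw [dt_mul, dt_mul, dt_del, mul_zero, add_zero, h.sato, pow_eq, neg_mul, mul_assoc _ W, ← hLW,
      mul_neg, ← sub_eq_add_neg, sub_eq_iff_eq_add] at h1
    refine hcancel _ _ (h1.trans ?_)
    rw [PDO.comm, B_eq]
    have h2 : L ^ (2 * k + 1) * L = L * L ^ (2 * k + 1) := by rw [← pow_succ, ← pow_succ']
    simp only [sub_mul, mul_sub, h2]
    noncomm_ring
  · have h1 := congrArg (PDO.dz δ) hLW
    rw [dz_mul, dz_mul, dz_del, mul_zero, add_zero, h.ghost_flow, mul_assoc _ W, ← hLW,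
      ← eq_sub_iff_add_eq] at h1
    refine hcancel _ _ (h1.trans ?_)
    rw [PDO.comm]
    noncomm_ring

end main

end BKP

namespace BKP

open PDO

/-! ### Commutator identities behind flatness. -/

section algebra

variable {A : Type*} [CommRing A] {L : PDO A}

theorem pow_comm_of_derivation {D : PDO A → PDO A} (hD : ∀ P Q, D (P * Q) = D P * Q + P * D Q)
    (h1 : D 1 = 0) {X : PDO A} (hL : D L = PDO.comm X L) (n : ℕ) :
    D (L ^ n) = PDO.comm X (L ^ n) := by
  induction n with
  | zero => rw [pow_zero, h1, PDO.comm, mul_one, one_mul, sub_self]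
  | succ n ih =>
    rw [pow_succ, hD, ih, hL, PDO.comm, PDO.comm, PDO.comm]
    noncomm_ring

theorem act_dx {P : PDO A} (hP : IsDiff P) (f : Fn A) : P.act (dx f) = (P * del).act f := by
  rw [act_eq, act_eq, fn_dx, mul_sub, coeff_sub, ← mul_assoc, ← mul_assoc, coeff_mul_del,
    hP.mul (isDiff_fn f) _ (by norm_num), sub_zero]

/-- By `ghost_mul_delInv`, the ghost operator times ∂⁻¹ is self-adjoint. -/
theorem adj_ghost (q r : Fn A) : (ghost q r).adj * del = -(del * ghost q r) := by
  have h1 : (ghost q r * delInv).adj = ghost q r * delInv := by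
    rw [ghost_mul_delInv, adj_sub, adj_fn_delInv_fn, adj_fn_delInv_fn]; abel
  rw [adj_mul, adj_delInv] at h1
  rw [← del_mul_delInv_mul ((ghost q r).adj), ← neg_neg (delInv * _), ← neg_mul, h1]
  simp only [mul_neg, neg_mul, mul_assoc, delInv_mul_del, mul_one]

/-- Expanding ab = ba with a = a₊ + α and b = b₊ + β, the commutator of a₊ and b₊ is differential
and drops out of the negative part, while that of α and β is kept whole. -/
theorem zeroCurvature (a b α β : PDO A) (hab : a * b = b * a) (hα : a.negPart = α)
    (hβ : b.negPart = β) : (PDO.comm (a - α) b).negPart + α * β =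
      (PDO.comm (b - β) a).negPart + β * α := by
  have ha : IsDiff (a - α) := by rw [← hα, ← pos_eq]; exact isDiff_pos a
  have hb : IsDiff (b - β) := by rw [← hβ, ← pos_eq]; exact isDiff_pos b
  have hα' : OrdLE α (-1) := hα ▸ ordLE_negPart a
  have hβ' : OrdLE β (-1) := hβ ▸ ordLE_negPart b
  have h1 : PDO.comm (a - α) b = PDO.comm (b - β) a -
      ((b - β) * (a - α) - (a - α) * (b - β)) + (β * α - α * β) := by
    have h2 : PDO.comm (a - α) b - (PDO.comm (b - β) a -
        ((b - β) * (a - α) - (a - α) * (b - β)) + (β * α - α * β)) = a * b - b * a := by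
      simp only [PDO.comm]; noncomm_ring
    rw [hab, sub_self] at h2
    exact sub_eq_zero.mp h2
  rw [h1, negPart_add, negPart_sub, ((hb.mul ha).sub (ha.mul hb)).negPart_eq_zero,
    ((hβ'.mul_neg hα').sub (hα'.mul_neg hβ')).negPart_eq]
  abel

end algebra

/-! ### The Poincaré lemma. -/

section poincare

variable {A : Type*} [CommRing A] [Algebra ℚ A]

/-- The formal Poincaré lemma in countably many variables. -/
theorem exists_potential (e : ℕ → Fn A) (he : ∀ j k, pderiv A j (e k) = pderiv A k (e j)) :
    ∃ φ : Fn A, ∀ k, pderiv A k φ = e k := by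
  classical
  -- Integrate each monomial along an arbitrarily chosen variable occurring in it; closedness makes
  -- the choice immaterial.
  let φ : Fn A := fun m => if h : ∃ k, m k ≠ 0 then
    ((m h.choose : ℚ)⁻¹) • coeff (m - Finsupp.single h.choose 1) (e h.choose) else 0
  have hφ : ∀ m : ℕ →₀ ℕ, (∃ k, m k ≠ 0) → ∃ k, m k ≠ 0 ∧
      coeff m φ = ((m k : ℚ)⁻¹) • coeff (m - Finsupp.single k 1) (e k) := fun m h =>
    ⟨h.choose, h.choose_spec, dif_pos h⟩
  refine ⟨φ, fun j => ?_⟩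
  ext m
  obtain ⟨k, hk, hcoeff⟩ := hφ (m + Finsupp.single j 1) ⟨j, by simp⟩
  rw [coeff_pderiv, hcoeff]
  rcases eq_or_ne k j with rfl | hkj
  · rw [add_tsub_cancel_right, Finsupp.add_apply, Finsupp.single_eq_same, smul_mul_assoc,
      ← Nat.cast_succ, mul_comm, ← nsmul_eq_mul, ← Nat.cast_smul_eq_nsmul ℚ, smul_smul,
      inv_mul_cancel₀ (by positivity), one_smul]
  · rw [Finsupp.add_apply, Finsupp.single_eq_of_ne hkj, add_zero] at hk ⊢
    have hle : Finsupp.single k 1 ≤ m := by rw [Finsupp.single_le_iff]; omega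
    obtain ⟨d, rfl⟩ := exists_add_of_le hle
    have h1 := congrArg (coeff d) (he j k)
    rw [coeff_pderiv, coeff_pderiv] at h1
    rw [add_assoc, add_tsub_cancel_left, Finsupp.add_apply, Finsupp.add_apply,
      Finsupp.single_eq_same, Finsupp.single_eq_of_ne hkj.symm, zero_add, smul_mul_assoc, h1,
      add_comm d, add_comm 1, ← Nat.cast_succ, mul_comm, ← nsmul_eq_mul,
      ← Nat.cast_smul_eq_nsmul ℚ, smul_smul, inv_mul_cancel₀ (by positivity), one_smul]

end poincare

/-! ### The flows in z and t treated uniformly. -/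

section flows

variable {A : Type*} [CommRing A] [Algebra ℚ A] (δ : Derivation ℚ A A)

/-- The derivations `∂_z` and `∂/∂tₙ` of the algebra of functions. -/
def flowFn : Option ℕ → Fn A →+ Fn A
  | none => dzFn δ
  | some k => (pderiv A k).toLinearMap.toAddMonoidHom

/-- The derivations `∂_z` and `∂/∂tₙ` acting coefficientwise on operators. -/
def flow : Option ℕ → PDO A → PDO A
  | none => PDO.dz δ
  | some k => PDO.dt k

theorem coeff_flow (i : Option ℕ) (P : PDO A) (m : ℤ) :
    (flow δ i P).coeff m = flowFn δ i (P.coeff m) := by cases i <;> rfl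

theorem flow_add (i : Option ℕ) (P Q : PDO A) : flow δ i (P + Q) = flow δ i P + flow δ i Q :=
  ext' fun m => by simp only [coeff_flow, coeff_add, map_add]

theorem flow_sub (i : Option ℕ) (P Q : PDO A) : flow δ i (P - Q) = flow δ i P - flow δ i Q :=
  ext' fun m => by simp only [coeff_flow, coeff_sub, map_sub]

theorem flow_mul (i : Option ℕ) (P Q : PDO A) :
    flow δ i (P * Q) = flow δ i P * Q + P * flow δ i Q := by
  cases i
  exacts [dz_mul δ P Q, dt_mul _ P Q]

theorem flow_adj (i : Option ℕ) (P : PDO A) : flow δ i P.adj = (flow δ i P).adj := by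
  cases i
  exacts [dz_adj δ P, dt_adj _ P]

theorem flow_del (i : Option ℕ) : flow δ i del = 0 := by
  cases i
  exacts [dz_del δ, dt_del _]

theorem flow_one (i : Option ℕ) : flow δ i 1 = 0 := by
  cases i
  exacts [dz_one δ, dt_one _]

theorem flow_flow (i j : Option ℕ) (P : PDO A) :
    flow δ i (flow δ j P) = flow δ j (flow δ i P) := by
  cases i <;> cases j
  exacts [rfl, dz_dt δ _ P, (dz_dt δ _ P).symm, dt_dt _ _ P]

theorem PDO.OrdLE.flow {P : PDO A} {N : ℤ} (hP : OrdLE P N) (i : Option ℕ) :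
    OrdLE (flow δ i P) N := fun m hm => by rw [coeff_flow, hP m hm, map_zero]

/-- Integrate in t first. The remaining defect in the z-direction has zero t-derivatives by
closedness, so it lies in `A`, and a `δ`-antiderivative of it corrects the potential. -/
theorem exists_flow_potential (hδ : Function.Surjective δ) (e : Option ℕ → Fn A)
    (he : ∀ i j, flowFn δ i (e j) = flowFn δ j (e i)) : ∃ φ, ∀ i, flowFn δ i φ = e i := by
  obtain ⟨φ, hφ⟩ := exists_potential (fun k => e (some k)) fun j k => he (some j) (some k)
  obtain ⟨b, hb⟩ := hδ (constantCoeff (e none - dzFn δ φ))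
  have hC : dzFn δ (C b) = C (δ b) := by
    classical
    ext m
    rw [coeff_dzFn, coeff_C, coeff_C]
    split_ifs
    · rfl
    · exact map_zero δ
  have : IsAddTorsionFree A := IsAddTorsionFree.of_module_rat A
  refine ⟨φ + C b, fun i => ?_⟩
  rcases i with _ | k
  · have hconst : e none - dzFn δ φ = C (constantCoeff (e none - dzFn δ φ)) := by
      refine pderiv.ext (fun k => ?_) (by rw [constantCoeff_C])
      rw [pderiv_C, map_sub, ← dzFn_pderiv, hφ, sub_eq_zero]
      exact he (some k) none
    change dzFn δ (φ + C b) = e none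
    rw [map_add, hC, hb, ← hconst, add_sub_cancel]
  · change pderiv A k (φ + C b) = e (some k)
    rw [map_add, pderiv_C, add_zero, hφ]

end flows

/-! ### Horizontal dressing operators of flat connections. -/

section existence

variable {A : Type*} [CommRing A] [Algebra ℚ A] (δ : Derivation ℚ A A)

/-- `W` solves `∂ᵢ W + Nᵢ W = 0` and `W* ∂ W = ∂` up to terms of low order. -/
structure IsApproxDressing (N : Option ℕ → PDO A) (n : ℕ) (W : PDO A) : Prop where
  monic : IsMonic W
  flow : ∀ i, OrdLE (flow δ i W + N i * W) (-(n + 1 : ℕ))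
  constraint : OrdLE (W.adj * del * W - del) (-n)

/-- A flat connection `∂ᵢ + Nᵢ` of negative order that preserves the BKP constraint. -/
structure IsFlatConnection (N : Option ℕ → PDO A) : Prop where
  ordLE : ∀ i, OrdLE (N i) (-1)
  flat : ∀ i j, flow δ i (N j) + N i * N j = flow δ j (N i) + N j * N i
  adj : ∀ i, (N i).adj * del = -(del * N i)

variable {δ} {N : Option ℕ → PDO A}

/-- Let eᵢ and χ be the leading coefficients of the errors in the flows and in the constraint;
adding a ∂⁻ⁿ⁻¹ to W must cancel both. Flatness gives ∂ᵢeⱼ = ∂ⱼeᵢ, invariance of the constraint gives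
∂ᵢχ = ((-1)ⁿ⁺¹ + 1) eᵢ, and skew-adjointness of W* ∂ W - ∂ gives χ = 0 for even n. Hence the two
requirements on `a` are compatible. -/
theorem IsApproxDressing.exists_correction (hN : IsFlatConnection δ N)
    (hδ : Function.Surjective δ) {n : ℕ} {W : PDO A} (h : IsApproxDressing δ N n W) :
    ∃ a : Fn A, (∀ i, (BKP.flow δ i W + N i * W).coeff (-(n + 1 : ℕ)) + flowFn δ i a = 0) ∧
      (W.adj * del * W - del).coeff (-n) +
        ((((Int.negOnePow (-(n + 1 : ℕ)) : ℤˣ) : ℤ) • a) + a) = 0 := by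
  set E := fun i => BKP.flow δ i W + N i * W with hE
  set X := W.adj * del * W - del with hX
  have hEord : ∀ i, OrdLE (E i) (-(n + 1 : ℕ)) := h.flow
  have hXord : OrdLE X (-n) := h.constraint
  have hW0 := h.monic.ordLE
  have hW1 := ((isMonic_iff W).mp h.monic).1
  have hclosed : ∀ i j, flowFn δ i ((E j).coeff (-(n + 1 : ℕ))) =
      flowFn δ j ((E i).coeff (-(n + 1 : ℕ))) := by
    intro i j
    -- Flatness applied to `W`. The products N E have lower order, so only the derivatives of the
    -- leading coefficients remain.
    have h1 : BKP.flow δ i (E j) + N i * E j = BKP.flow δ j (E i) + N j * E i := by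
      have h2 := congrArg (· * W) (hN.flat i j)
      simp only [add_mul] at h2
      simp only [hE, flow_add, flow_mul, mul_add, flow_flow δ i j W]
      rw [← sub_eq_zero] at h2 ⊢
      rw [← h2]
      noncomm_ring
    have h3 : ∀ i j, (N i * E j).coeff (-(n + 1 : ℕ)) = 0 := fun i j =>
      ((hN.ordLE i).mul (hEord j)) _ (by omega)
    have h4 := congrArg (PDO.coeff · (-(n + 1 : ℕ))) h1
    simpa only [coeff_add, h3, add_zero, coeff_flow] using h4
  have hXflow : ∀ i, flowFn δ i (X.coeff (-n)) =
      ((Int.negOnePow (-(n + 1 : ℕ)) : ℤˣ) : ℤ) • (E i).coeff (-(n + 1 : ℕ)) +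
        (E i).coeff (-(n + 1 : ℕ)) := by
    intro i
    have h1 : BKP.flow δ i W = E i - N i * W := by simp only [hE]; abel
    have h2 : BKP.flow δ i X = (E i).adj * del * W + W.adj * del * E i := by
      rw [hX, flow_sub, flow_mul, flow_mul, flow_del, flow_adj, h1, adj_sub, adj_mul]
      have h3 : W.adj * (N i).adj * del * W = -(W.adj * del * N i * W) := by
        rw [mul_assoc W.adj, hN.adj]; noncomm_ring
      simp only [sub_mul, mul_sub, mul_zero, add_zero, sub_zero, h3]
      noncomm_ring
    have h4 := congrArg (PDO.coeff · (-n : ℤ)) h2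
    simp only [coeff_flow, coeff_add] at h4
    rw [h4]
    have h5 := coeff_mul_top ((hEord i).adj.mul ordLE_del) hW0
    rw [coeff_mul_top (hEord i).adj ordLE_del, coeff_adj_top (hEord i), hW1, del, coeff_mono_self,
      mul_one, mul_one] at h5
    have h6 := coeff_mul_top (hW0.adj.mul ordLE_del) (hEord i)
    rw [coeff_mul_top hW0.adj ordLE_del, coeff_adj_top hW0, hW1, del, coeff_mono_self,
      Int.negOnePow_zero, Units.val_one, one_smul, one_mul, one_mul] at h6
    rw [← h5, ← h6]
    congr 2 <;> · push_cast; ring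
  have hXadj : ((Int.negOnePow (-n) : ℤˣ) : ℤ) • X.coeff (-n) = -X.coeff (-n) := by
    have h1 : X.adj = -X := by
      rw [hX, adj_sub, adj_mul, adj_mul, adj_adj, adj_del]
      noncomm_ring
    rw [← coeff_adj_top hXord, h1, coeff_neg]
  have hsign := Int.negOnePow_sub (-n) 1
  rw [show (-n - 1 : ℤ) = -(n + 1 : ℕ) by push_cast; ring] at hsign
  -- For even n, χ = 0 and `a` drops out of the constraint, so any potential of -eᵢ will do. For odd
  -- n the constraint forces a = -χ/2, and ∂ᵢχ = 2eᵢ gives the flow equations.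
  rcases Int.even_or_odd (-n) with hn | hn
  · rw [Int.negOnePow_even _ hn, Units.val_one, one_smul] at hXadj
    obtain ⟨a, ha⟩ := exists_flow_potential δ hδ (fun i => -(E i).coeff (-(n + 1 : ℕ)))
      fun i j => by rw [map_neg, map_neg, hclosed]
    refine ⟨a, fun i => by rw [ha, add_neg_cancel], ?_⟩
    rw [fn_eq_zero_of_eq_neg hXadj, hsign, Int.negOnePow_even _ hn]
    simp
  · rw [Int.negOnePow_odd _ hn] at hsign
    have hsign' : Int.negOnePow (-(n + 1 : ℕ)) = 1 := by rw [hsign]; simp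
    simp only [hsign', Units.val_one, one_smul] at hXflow ⊢
    refine ⟨(-(1 / 2) : ℚ) • X.coeff (-n), fun i => ?_, ?_⟩
    · rw [map_rat_smul, hXflow]
      module
    · module

theorem IsApproxDressing.succ (hN : IsFlatConnection δ N) {n : ℕ} {W : PDO A}
    (h : IsApproxDressing δ N n W) {a : Fn A}
    (ha : ∀ i, (BKP.flow δ i W + N i * W).coeff (-(n + 1 : ℕ)) + flowFn δ i a = 0)
    (hc : (W.adj * del * W - del).coeff (-n) +
        ((((Int.negOnePow (-(n + 1 : ℕ)) : ℤˣ) : ℤ) • a) + a) = 0) :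
    IsApproxDressing δ N (n + 1) (W + mono a (-(n + 1 : ℕ))) := by
  have hY : OrdLE (mono a (-(n + 1 : ℕ))) (-(n + 1 : ℕ)) := ordLE_mono _ _
  have hYtop : (mono a (-(n + 1 : ℕ))).coeff (-(n + 1 : ℕ)) = a := coeff_mono_self _ _
  generalize mono a (-(n + 1 : ℕ)) = Y at hY hYtop ⊢
  have hW0 := h.monic.ordLE
  have hW1 := ((isMonic_iff W).mp h.monic).1
  refine ⟨?_, fun i => ?_, ?_⟩
  · rw [IsMonic, add_sub_right_comm]
    exact OrdLE.add h.monic (hY.mono_bound (by omega))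
  · have h1 : BKP.flow δ i (W + Y) + N i * (W + Y) =
        BKP.flow δ i W + N i * W + (BKP.flow δ i Y + N i * Y) := by
      rw [flow_add, mul_add]; abel
    have h2 := (hN.ordLE i).mul hY
    have h3 : OrdLE (BKP.flow δ i (W + Y) + N i * (W + Y)) (-(n + 1 : ℕ)) := by
      rw [h1]
      exact (h.flow i).add ((hY.flow δ i).add (h2.mono_bound (by omega)))
    refine (h3.lower ?_).mono_bound (by push_cast; omega)
    rw [h1, coeff_add, coeff_add _ (N i * Y), h2 _ (by omega), add_zero, coeff_flow, hYtop, ha]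
  · have h1 : (W + Y).adj * del * (W + Y) - del = (W.adj * del * W - del) +
        (Y.adj * del * W + W.adj * del * Y + Y.adj * del * Y) := by
      rw [adj_add]; noncomm_ring
    have o1 := (hY.adj.mul ordLE_del).mul hW0
    have o2 := (hW0.adj.mul ordLE_del).mul hY
    have o3 := (hY.adj.mul ordLE_del).mul hY
    have h2 : OrdLE ((W + Y).adj * del * (W + Y) - del) (-n) := by
      rw [h1]
      exact h.constraint.add (((o1.mono_bound (by push_cast; omega)).add
        (o2.mono_bound (by push_cast; omega))).add (o3.mono_bound (by push_cast; omega)))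
    refine (h2.lower ?_).mono_bound (by push_cast; omega)
    have h5 := coeff_mul_top (hY.adj.mul ordLE_del) hW0
    rw [coeff_mul_top hY.adj ordLE_del, coeff_adj_top hY, hW1, del, coeff_mono_self,
      mul_one, mul_one, hYtop] at h5
    have h6 := coeff_mul_top (hW0.adj.mul ordLE_del) hY
    rw [coeff_mul_top hW0.adj ordLE_del, coeff_adj_top hW0, hW1, del, coeff_mono_self,
      Int.negOnePow_zero, Units.val_one, one_smul, one_mul, one_mul, hYtop] at h6
    rw [show -((n + 1 : ℕ) : ℤ) + 1 + 0 = -n by push_cast; ring] at h5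
    rw [show 0 + 1 + -((n + 1 : ℕ) : ℤ) = -n by push_cast; ring] at h6
    rw [h1, coeff_add, coeff_add, coeff_add, del, h5, h6, ← del, o3 _ (by push_cast; omega),
      add_zero, hc]

/-- A flat connection preserving the BKP constraint has a horizontal dressing operator. -/
theorem IsFlatConnection.exists_dressing (hN : IsFlatConnection δ N)
    (hδ : Function.Surjective δ) : ∃ W : PDO A, IsMonic W ∧ (∀ i, flow δ i W + N i * W = 0) ∧
      W.adj * del * W = del := by
  have h0 : IsApproxDressing δ N 0 1 := by
    refine ⟨?_, fun i => ?_, ?_⟩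
    · rw [IsMonic, sub_self]; exact ordLE_zero _
    · rw [flow_one, zero_add, mul_one]; exact hN.ordLE i
    · rw [adj_one, one_mul, mul_one, sub_self]; exact ordLE_zero _
  have hstep : ∀ n W, IsApproxDressing δ N n W →
      ∃ a, IsApproxDressing δ N (n + 1) (W + mono a (-(n + 1 : ℕ))) := by
    intro n W h
    obtain ⟨a, ha, hc⟩ := h.exists_correction hN hδ
    exact ⟨a, h.succ hN ha hc⟩
  choose a ha using hstep
  let s : ∀ n, {W // IsApproxDressing δ N n W} := fun n =>
    Nat.rec ⟨1, h0⟩ (fun n p => ⟨_, ha n p.1 p.2⟩) n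
  have hs : ∀ n, (s (n + 1)).1 = (s n).1 + mono (a n (s n).1 (s n).2) (-(n + 1 : ℕ)) :=
    fun n => rfl
  obtain ⟨W, hW⟩ := exists_limit (fun n => (s n).1) fun n => by
    rw [hs, add_sub_cancel_left]; exact ordLE_mono _ _
  have hmon : IsMonic W := hW 0
  refine ⟨W, hmon, fun i => ?_, ?_⟩
  · refine eq_zero_of_forall_ordLE fun n => ?_
    have h1 : flow δ i W + N i * W = (flow δ i (s n).1 + N i * (s n).1) +
        (flow δ i (W - (s n).1) + N i * (W - (s n).1)) := by
      rw [flow_sub, mul_sub]; abel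
    rw [h1]
    exact (((s n).2.flow i).mono_bound (by omega)).add ((((hW n).flow δ i).mono_bound
      (by omega)).add (((hN.ordLE i).mul (hW n)).mono_bound (by omega)))
  · refine sub_eq_zero.mp (eq_zero_of_forall_ordLE fun n => ?_)
    -- Replace `W` by its approximation one factor at a time; every replacement costs a term of
    -- order at most -n.
    have h1 : W.adj * del * W - del = ((s n).1.adj * del * (s n).1 - del) +
        ((W - (s n).1).adj * del * W + (s n).1.adj * del * (W - (s n).1)) := by
      rw [adj_sub]; noncomm_ring
    rw [h1]
    exact (s n).2.constraint.add (((((hW n).adj.mul ordLE_del).mul hmon.ordLE).mono_bound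
      (by omega)).add ((((s n).2.monic.ordLE.adj.mul ordLE_del).mul (hW n)).mono_bound (by omega)))

end existence

/-! ### From a solution of the hierarchy to its dressing operator. -/

section solution

variable {A : Type*} [CommRing A] [Algebra ℚ A] {δ : Derivation ℚ A A} {L : PDO A} {q r : Fn A}

/-- The constraint for Lⁿ splits into its two parts because conjugation by ∂ keeps Bₙ differential.
That requires the zeroth coefficient of Bₙ to vanish, as otherwise Bₙ ∂⁻¹ would have a residue. -/
theorem adj_negPart_B (hL : L.adj = -(del * L * delInv)) (k : ℕ) :
    (L ^ (2 * k + 1)).negPart.adj = -(del * (L ^ (2 * k + 1)).negPart * delInv) ∧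
      (B L (2 * k + 1)).adj = -(del * B L (2 * k + 1) * delInv) := by
  have h0 := coeff_zero_B hL k
  have h1 := adj_pow_of_constraint hL k
  have hsum : L ^ (2 * k + 1) = B L (2 * k + 1) + (L ^ (2 * k + 1)).negPart := by
    rw [B_eq]; abel
  have hℓ := ordLE_negPart (L ^ (2 * k + 1))
  have hB := isDiff_B L (2 * k + 1)
  generalize (L ^ (2 * k + 1)).negPart = ℓ at *
  generalize B L (2 * k + 1) = Bk at *
  rw [hsum, adj_add] at h1
  have h2 : IsDiff (Bk.adj + del * Bk * delInv) := by
    refine hB.adj.add ?_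
    rw [mul_assoc]
    refine isDiff_del.mul fun i hi => ?_
    rw [coeff_mul_delInv]
    rcases eq_or_ne i (-1) with rfl | hi'
    · exact h0
    · exact hB _ (by omega)
  have h3 : OrdLE (ℓ.adj + del * ℓ * delInv) (-1) :=
    hℓ.adj.add (((ordLE_del.mul hℓ).mul ordLE_delInv).mono_bound (by norm_num))
  have h4 : Bk.adj + del * Bk * delInv = -(ℓ.adj + del * ℓ * delInv) := by
    rw [eq_neg_iff_add_eq_zero]
    have : Bk.adj + del * Bk * delInv + (ℓ.adj + del * ℓ * delInv) =
        Bk.adj + ℓ.adj + del * (Bk + ℓ) * delInv := by noncomm_ring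
    rw [this, h1, neg_add_cancel]
  have h5 := eq_zero_of_isDiff h2 (h4 ▸ h3.neg)
  rw [h5, eq_comm, neg_eq_zero] at h4
  exact ⟨eq_neg_of_add_eq_zero_left h4, eq_neg_of_add_eq_zero_left h5⟩

theorem act_adj_B (hL : L.adj = -(del * L * delInv)) (k : ℕ) (f : Fn A) :
    (B L (2 * k + 1)).adj.act (dx f) = -dx ((B L (2 * k + 1)).act f) := by
  have hB := isDiff_B L (2 * k + 1)
  rw [act_dx hB.adj, (adj_negPart_B hL k).2, neg_mul, mul_assoc _ delInv, delInv_mul_del, mul_one,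
    act_eq, neg_mul, coeff_neg, mul_assoc, coeff_del_mul, hB.mul (isDiff_fn f) (0 - 1) (by norm_num),
    add_zero, act_eq]

/-- Left multiplication by Bₙ acts on the left functions as Bₙ, and right multiplication acts on the
right functions as Bₙ*. Since Bₙ*(fₓ) = -(Bₙ f)ₓ, the commutator differentiates all four functions
along tₙ. -/
theorem dt_ghost (hL : L.adj = -(del * L * delInv)) (hq : IsEigenfunction L q)
    (hr : IsEigenfunction L r) (k : ℕ) :
    (ghost q r).dt k = (PDO.comm (B L (2 * k + 1)) (ghost q r)).negPart := by
  have hB := isDiff_B L (2 * k + 1)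
  have hdx : ∀ f : Fn A, pderiv A k (dx f) = dx (pderiv A k f) := fun f => pderiv_comm k 0 f
  rw [PDO.comm, ghost, mul_sub, sub_mul, negPart_sub, negPart_sub, negPart_sub,
    negPart_diff_mul_mul hB, negPart_diff_mul_mul hB, negPart_mul_diff hB, negPart_mul_diff hB,
    act_adj_B hL, act_adj_B hL, ← hq k, ← hr k]
  simp only [dt_sub, dt_mul, dt_fn, dt_delInv, hdx, fn_neg, mul_zero, add_zero, mul_neg]
  abel

/-- The connection whose horizontal sections are the dressing operators of a solution. -/
def saConnection (L : PDO A) (q r : Fn A) : Option ℕ → PDO A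
  | none => -ghost q r
  | some k => (L ^ (2 * k + 1)).negPart

theorem IsSolution.isFlatConnection (h : IsSolution δ L q r) :
    IsFlatConnection δ (saConnection L q r) := by
  have hℓt : ∀ j k, (L ^ (2 * k + 1)).negPart.dt j =
      (PDO.comm (B L (2 * j + 1)) (L ^ (2 * k + 1))).negPart := fun j k => by
    rw [← negPart_dt, pow_comm_of_derivation (dt_mul j) (dt_one j) (h.lax j)]
  have hmixed : ∀ k, (ghost q r).dt k + (L ^ (2 * k + 1)).negPart.dz δ =
      ghost q r * (L ^ (2 * k + 1)).negPart - (L ^ (2 * k + 1)).negPart * ghost q r := by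
    intro k
    have hℓ := ordLE_negPart (L ^ (2 * k + 1))
    have hM := ordLE_ghost q r
    -- With M the ghost operator, [Bₙ, M] + [M, Lⁿ] = [M, (Lⁿ)₋], which already has negative order.
    rw [← negPart_dz, pow_comm_of_derivation (dz_mul δ) (dz_one δ) h.ghost_flow,
      dt_ghost h.constraint h.eigen_q h.eigen_r, ← negPart_add, B_eq,
      ← ((hM.mul_neg hℓ).sub (hℓ.mul_neg hM)).negPart_eq]
    congr 1
    simp only [PDO.comm]
    noncomm_ring
  refine ⟨?_, ?_, ?_⟩
  · rintro (_ | k)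
    exacts [(ordLE_ghost q r).neg, ordLE_negPart _]
  · rintro (_ | j) (_ | k)
    · rfl
    · have := hmixed k
      change (L ^ (2 * k + 1)).negPart.dz δ + -ghost q r * (L ^ (2 * k + 1)).negPart =
        (-ghost q r).dt k + (L ^ (2 * k + 1)).negPart * -ghost q r
      rw [eq_sub_iff_add_eq, ← sub_eq_zero] at this
      rw [dt_neg, ← sub_eq_zero, ← this]
      noncomm_ring
    · have := hmixed j
      change (-ghost q r).dt j + (L ^ (2 * j + 1)).negPart * -ghost q r =
        (L ^ (2 * j + 1)).negPart.dz δ + -ghost q r * (L ^ (2 * j + 1)).negPart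
      rw [eq_sub_iff_add_eq, ← sub_eq_zero] at this
      rw [dt_neg, eq_comm, ← sub_eq_zero, ← this]
      noncomm_ring
    · change (L ^ (2 * k + 1)).negPart.dt j + _ * _ = (L ^ (2 * j + 1)).negPart.dt k + _ * _
      rw [hℓt, hℓt, B_eq, B_eq]
      exact zeroCurvature _ _ _ _ (by rw [← pow_add, ← pow_add, add_comm]) rfl rfl
  · rintro (_ | k)
    · change (-ghost q r).adj * del = -(del * -ghost q r)
      rw [adj_neg, neg_mul, adj_ghost, mul_neg]
    · change (L ^ (2 * k + 1)).negPart.adj * del = _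
      rw [(adj_negPart_B h.constraint k).1, neg_mul, mul_assoc _ delInv, delInv_mul_del, mul_one]
      rfl

theorem IsSolution.exists_dressing (hδ : Function.Surjective δ) (h : IsSolution δ L q r) :
    ∃ W, Dresses W L ∧ IsDressedSolution δ L W q r := by
  obtain ⟨W, hmon, hflow, hcon⟩ := h.isFlatConnection.exists_dressing hδ
  obtain ⟨V, hWV, hVW⟩ := exists_inverse hmon
  have ht : ∀ k, W.dt k = -((L ^ (2 * k + 1)).negPart * W) := fun k =>
    eq_neg_of_add_eq_zero_left (hflow (some k))
  have hz : W.dz δ = ghost q r * W := by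
    have := eq_neg_of_add_eq_zero_left (hflow none)
    exact this.trans (by rw [saConnection, neg_mul, neg_neg])
  have hL : L = del + L.negPart := ext' fun i => by
    rw [coeff_add, del, coeff_mono, coeff_negPart]
    rcases lt_trichotomy i 0 with hi | rfl | hi
    · rw [if_neg (by omega), if_pos hi, zero_add]
    · rw [h.form.2.1]; simp
    · rcases eq_or_ne i 1 with rfl | hi1
      · rw [h.form.1]; simp
      · rw [h.form.2.2 i (by omega), if_neg hi1, if_neg (by omega), add_zero]
  have hLW : L * W = W * del := by
    -- The Sato equation for t₁ = x, namely Wₓ = -L₋ W, is what makes W dress the given L: then L W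
    -- = ∂ W - Wₓ = W ∂.
    have h0 := ht 0
    rw [mul_zero, zero_add, pow_one] at h0
    rw [hL, add_mul, ← dt_zero_add, h0]
    abel
  refine ⟨W, ⟨(isMonic_iff W).mp hmon, V, hWV, hVW, ?_⟩,
    ⟨fun k => by rw [pow_eq, ht], hcon, hz, h.eigen_q, h.eigen_r⟩⟩
  rw [← hLW, mul_assoc, hWV, mul_one]

end solution

end BKP

end

theorem theorem2p1 {A : Type*} [CommRing A] [Algebra ℚ A] (δ : Derivation ℚ A A)
    (q r : BKP.Fn A) :
    -- a dressing operator solves the hierarchy iff its wave function satisfies the identities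
    (∀ L W : BKP.PDO A, BKP.Dresses W L →
      (BKP.IsDressedSolution δ L W q r ↔ BKP.ResidueIdentities δ W q r)) ∧
    -- the identities imply the hierarchy for `L = W ∂ W⁻¹`
    (∀ L W : BKP.PDO A, BKP.Dresses W L → BKP.ResidueIdentities δ W q r →
      BKP.IsSolution δ L q r) ∧
    -- the hierarchy is equivalent to the identities for some wave function of `L`
    (Function.Surjective δ → ∀ L : BKP.PDO A,
      (BKP.IsSolution δ L q r ↔
        ∃ W : BKP.PDO A, BKP.Dresses W L ∧ BKP.ResidueIdentities δ W q r)) := by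
  refine ⟨fun L W hWL => ⟨fun h => h.residueIdentities hWL, fun h => h.isDressedSolution hWL⟩,
    fun L W hWL h => (h.isDressedSolution hWL).isSolution hWL, fun hδ L => ⟨fun h => ?_, ?_⟩⟩
  · obtain ⟨W, hWL, hW⟩ := h.exists_dressing hδ
    exact ⟨W, hWL, hW.residueIdentities hWL⟩
  · rintro ⟨W, hWL, h⟩
    exact (h.isDressedSolution hWL).isSolution hWL
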